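/- **Theorem (Lagrangian sampling).** *Notation.* For $f,g:\mathbb F_2^n\to\mathbb C$ let $\langle f,g\rangle=\mathbb E_x f(x)\overline{g(x)}$, $\|f\|_2=\langle f,f\rangle^{1/2}$, $\hat f(b)=\mathbb E_x f(x)(-1)^{b\cdot x}$, $\Delta_af(x)=f(x+a)\overline{f(x)}$, and $\|f\|_{U^3}=(\mathbb E_{x,a,b,c}\Delta_a\Delta_b\Delta_cf(x))^{1/8}$. A *stabilizer state* is a function $\phi$ with $\|\phi\|_2=\|\phi\|_{U^3}=1$, and $\mathcal L(\phi)=\{(a,b)\in\mathbb F_2^n\times\mathbb F_2^n: |\widehat{\Delta_a\phi}(b)|=1\}$. A stabilizer state $\phi$ is a *$\gamma$-approximate local maximizer of correlation for $f$* if $|\langle f,\phi\rangle|^2\ge\gamma|\langle f,\phi'\rangle|^2$ for every stabilizer state $\phi'$ with $|\langle\phi,\phi'\rangle|^2=\tfrac12$. For $f\ne0$ let $P_f(a,b)=|\widehat{\Delta_af}(b)|^2/(2^n\|f\|_2^4)$ and $Q_f=P_f*P_f$, a probability distribution on $\mathbb F_2^n\times\mathbb F_2^n$; a "sample from $Q_0$"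 is $(0,0)$ by convention. For $a,b\in\mathbb F_2^n$ and $\sigma\in\{-1,1\}$ let $\Pi_{a,b}^{\sigma}f(x)=\tfrac12\big(f(x)+\sigma\, i^{|a\circ b|}(-1)^{b\cdot x}f(x+a)\big)$, where $|a\circ b|$ is the number of coordinates $j$ with $a_j=b_j=1$. *Robust generation.* Let $K>0$. On input $g:\mathbb F_2^n\to\mathbb C$ with parameters $\varepsilon,\delta,\kappa>0$ ($\kappa$ is a promised lower bound for $\|g\|_2^2$), draw $m=\lceil K(n+\log(1/\delta))/\varepsilon\rceil$ independent samples from $Q_g$. With $N=\lceil K\log(m/\delta)/(\kappa/1000)^2\rceil$, estimate $\widehat{\Delta_0g}(0)=\|g\|_2^2$, and $\widehat{\Delta_ag}(b)$ for each sampled $(a,b)$, each by the empirical mean, over $N$ fresh independent uniform points $x$, of $\Delta_0g(x)$, respectively $\Delta_ag(x)(-1)^{b\cdot x}$. Writing $c_0$ for the first estimate, keep the samples $(a,b)$ whose estimate has modulus greater than $0.711\,|c_0|$, and return a basis of the linear span of the kept samples. *$\mathrm{LagrangianSample}(f,\gamma,\tau)$.* Let $t=\lceil\log_{1.08}(1/\tau)\rceil$,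 let $s$ be uniformly random in $\{0,1,\dots,t\}$ and let $f_0=f$. For $i=1,\dots,t$ let $(a_i,b_i)$ be a sample from $Q_{f_{i-1}}$, let $\sigma_i\in\{-1,1\}$ be a uniformly random sign, and let $f_i=\Pi_{a_i,b_i}^{\sigma_i}f_{i-1}$. Return the output of robust generation on $f_s$ with $\varepsilon=(\gamma-\tfrac12)^2\tau^8/8$, $\delta=\tfrac12$ and $\kappa=\tau^2$. *Claim.* There are absolute constants $K_0,C>0$ such that the following holds for every $K\ge K_0$. Let $n\ge0$, let $\tfrac12<\gamma\le1$ and $\tau>0$, let $f:\mathbb F_2^n\to\mathbb C$ satisfy $|f(x)|\le1$ for all $x$, and let $\phi$ be a stabilizer state that is a $\gamma$-approximate local maximizer of correlation for $f$ and satisfies $|\langle f,\phi\rangle|\ge\tau$. Then $\mathrm{LagrangianSample}(f,\gamma,\tau)$ always returns a basis of a subspace $L\subseteq\mathbb F_2^n\times\mathbb F_2^n$, and $$\Pr[L=\mathcal L(\phi)]\ \ge\ \big((\gamma-\tfrac12)\tau\big)^{C\log(2/\tau)}.$$ -/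

import Mathlib

open scoped BigOperators ComplexConjugate

noncomputable section

namespace StabSampling

/-- The vector space `𝔽₂ⁿ`. -/
abbrev Vec (n : ℕ) : Type := Fin n → ZMod 2

/-- Phase space `𝔽₂ⁿ × 𝔽₂ⁿ`. -/
abbrev Phase (n : ℕ) : Type := Vec n × Vec n

/-- Complex-valued functions on `𝔽₂ⁿ`. -/
abbrev Fn (n : ℕ) : Type := Vec n → ℂ

variable {n : ℕ}

/-- `⟨f, g⟩ = 𝔼ₓ f(x) conj(g(x))`. -/
def ip (f g : Fn n) : ℂ := 𝔼 x, f x * conj (g x)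

/-- `‖f‖₂ = ⟨f, f⟩^{1/2}`. -/
def l2Norm (f : Fn n) : ℝ := Real.sqrt (𝔼 x, ‖f x‖ ^ 2)

/-- `|f(x)| ≤ 1` for all `x`. -/
def OneBounded (f : Fn n) : Prop := ∀ x, ‖f x‖ ≤ 1

/-- Multiplicative derivative `Δₐ f(x) = f(x + a) conj(f(x))`. -/
def mulDeriv (a : Vec n) (f : Fn n) : Fn n := fun x => f (x + a) * conj (f x)

/-- The `U³`-norm; the average below is a nonnegative real number, so taking its modulus does not
change it. -/
def u3Norm (f : Fn n) : ℝ :=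
  ‖𝔼 x : Vec n, 𝔼 a : Vec n, 𝔼 b : Vec n, 𝔼 c : Vec n,
    mulDeriv a (mulDeriv b (mulDeriv c f)) x‖ ^ (1 / 8 : ℝ)

/-- Stabilizer states: `‖φ‖₂ = ‖φ‖_{U³} = 1`. -/
def IsStabilizerState (φ : Fn n) : Prop := l2Norm φ = 1 ∧ u3Norm φ = 1

/-- `φ` is a `γ`-approximate local maximizer of correlation for `f`:
`|⟨f, φ⟩|² ≥ γ |⟨f, φ'⟩|²` for every stabilizer state `φ'` with `|⟨φ, φ'⟩|² = 1/2`. -/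
def IsApproxLocalMaximizer (γ : ℝ) (f φ : Fn n) : Prop :=
  IsStabilizerState φ ∧
    ∀ φ' : Fn n, IsStabilizerState φ' → ‖ip φ φ'‖ ^ 2 = 1 / 2 →
      γ * ‖ip f φ'‖ ^ 2 ≤ ‖ip f φ‖ ^ 2

/-- The character `(-1)^{b·x}`. -/
def chi (b x : Vec n) : ℂ := (-1) ^ (b ⬝ᵥ x).val

/-- Fourier coefficient `𝔼ₓ f(x) (-1)^{b·x}`. -/
def fourier (f : Fn n) (b : Vec n) : ℂ := 𝔼 x, f x * chi b x

/-- `𝓛(φ) = {(a, b) : |(Δₐφ)^(b)| = 1}`. -/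
def lagrangian (φ : Fn n) : Set (Phase n) := {v | ‖fourier (mulDeriv v.1 φ) v.2‖ = 1}

/-- Characteristic distribution `P_f(a, b) = |(Δₐf)^(b)|² / (2ⁿ ‖f‖₂⁴)`. -/
def charDist (f : Fn n) (v : Phase n) : ℝ :=
  ‖fourier (mulDeriv v.1 f) v.2‖ ^ 2 / (2 ^ n * l2Norm f ^ 4)

/-- Convoluted distribution `Q_f = P_f * P_f`. -/
def convDist (f : Fn n) (v : Phase n) : ℝ := ∑ w, charDist f w * charDist f (v - w)

/-! ### `Q_f` is a probability distribution -/

theorem chi_eq_prod (b x : Vec n) : chi b x = ∏ i, (-1 : ℂ) ^ (b i * x i).val := by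
  have key : ∀ s : Finset (Fin n),
      (-1 : ℂ) ^ (∑ i ∈ s, b i * x i).val = ∏ i ∈ s, (-1 : ℂ) ^ (b i * x i).val := by
    intro s
    induction s using Finset.induction_on with
    | empty => simp
    | insert i s hi ih =>
      rw [Finset.sum_insert hi, Finset.prod_insert hi, ← ih]
      generalize b i * x i = p
      generalize (∑ i ∈ s, b i * x i) = q
      rw [ZMod.val_add, ← pow_add]
      exact (neg_one_pow_eq_pow_mod_two (R := ℂ) _).symm
  exact key Finset.univ

theorem sum_chi (x : Vec n) : ∑ b : Vec n, chi b x = if x = 0 then (2 : ℂ) ^ n else 0 := by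
  simp only [chi_eq_prod]
  have h := Finset.prod_univ_sum (fun _ : Fin n => (Finset.univ : Finset (ZMod 2)))
    (fun i c => (-1 : ℂ) ^ (c * x i).val)
  rw [Fintype.piFinset_univ] at h
  rw [← h]
  have h2 : ∀ c : ZMod 2, ∑ d : ZMod 2, (-1 : ℂ) ^ (d * c).val = if c = 0 then 2 else 0 := by
    intro c
    have hs : ∀ F : ZMod 2 → ℂ, ∑ d : ZMod 2, F d = F 0 + F 1 := fun F => Fin.sum_univ_two F
    rw [hs]
    have hc : ∀ c : ZMod 2, c = 0 ∨ c = 1 := by decide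
    rcases hc c with rfl | rfl
    · norm_num
    · simp [ZMod.val_one]
  simp only [h2]
  split_ifs with hx
  · simp [hx]
  · obtain ⟨i, hi⟩ : ∃ i, x i ≠ 0 := by
      by_contra hcon
      push Not at hcon
      exact hx (funext hcon)
    exact Finset.prod_eq_zero (Finset.mem_univ i) (if_neg hi)

theorem chi_mul (b x y : Vec n) : chi b x * chi b y = chi b (x + y) := by
  simp only [chi, dotProduct_add, ZMod.val_add, ← pow_add]
  exact neg_one_pow_eq_pow_mod_two (R := ℂ) _

theorem conj_chi (b x : Vec n) : conj (chi b x) = chi b x := by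
  simp [chi]

theorem parseval (g : Fn n) : ∑ b, ‖fourier g b‖ ^ 2 = 𝔼 x, ‖g x‖ ^ 2 := by
  have hcard : ((Finset.univ : Finset (Vec n)).card : ℂ) = 2 ^ n := by
    simp
  have hC : ∑ b, fourier g b * conj (fourier g b) = 𝔼 x, g x * conj (g x) := by
    simp only [fourier, Finset.expect_eq_sum_div_card, hcard]
    have e : ∀ b : Vec n, (∑ x, g x * chi b x) / (2 : ℂ) ^ n *
        conj ((∑ x, g x * chi b x) / (2 : ℂ) ^ n) =
        (∑ x, ∑ y, g x * conj (g y) * chi b (x + y)) / ((2 : ℂ) ^ n * 2 ^ n) := by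
      intro b
      rw [map_div₀, map_sum, div_mul_div_comm, Finset.sum_mul_sum]
      simp only [map_mul, conj_chi, map_pow, Complex.conj_ofNat]
      congr 1
      refine Finset.sum_congr rfl fun x _ => Finset.sum_congr rfl fun y _ => ?_
      rw [← chi_mul]
      ring
    simp only [e]
    rw [← Finset.sum_div, Finset.sum_comm]
    have e2 : ∀ x : Vec n, ∑ b, ∑ y, g x * conj (g y) * chi b (x + y)
        = g x * conj (g x) * 2 ^ n := by
      intro x
      rw [Finset.sum_comm]
      simp only [← Finset.mul_sum, sum_chi]
      rw [Finset.sum_eq_single x]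
      · have : x + x = 0 := funext fun i => CharTwo.add_self_eq_zero (x i)
        simp [this]
      · intro y _ hy
        have : x + y ≠ 0 := by
          intro h0
          apply hy
          have : y = -x := (neg_eq_of_add_eq_zero_right h0).symm
          rw [this]
          exact funext fun i => CharTwo.neg_eq (x i)
        simp [this]
      · simp
    simp only [e2]
    rw [← Finset.sum_mul]
    field_simp
  have h1 : ∀ z : ℂ, z * conj z = ((‖z‖ ^ 2 : ℝ) : ℂ) := by
    intro z
    rw [Complex.mul_conj, Complex.normSq_eq_norm_sq]
  simp only [h1] at hC
  have : ((∑ b, ‖fourier g b‖ ^ 2 : ℝ) : ℂ) = ((𝔼 x, ‖g x‖ ^ 2 : ℝ) : ℂ) := by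
    rw [Finset.expect_eq_sum_div_card] at hC ⊢
    push_cast at hC ⊢
    exact hC
  exact_mod_cast this

theorem l2Norm_sq (f : Fn n) : l2Norm f ^ 2 = 𝔼 x, ‖f x‖ ^ 2 :=
  Real.sq_sqrt (Finset.expect_nonneg fun _ _ => by positivity)

theorem l2Norm_ne_zero {f : Fn n} (hf : f ≠ 0) : l2Norm f ≠ 0 := by
  intro h
  apply hf
  have h2 := l2Norm_sq f
  rw [h, Finset.expect_eq_sum_div_card] at h2
  have h3 : ∑ x, ‖f x‖ ^ 2 = 0 := by
    have hc : ((Finset.univ : Finset (Vec n)).card : ℝ) ≠ 0 := by simp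
    have h4 : (∑ x, ‖f x‖ ^ 2) / ((Finset.univ : Finset (Vec n)).card : ℝ) = 0 := by
      rw [← h2]; norm_num
    exact (div_eq_zero_iff.mp h4).resolve_right hc
  funext x
  have := (Finset.sum_eq_zero_iff_of_nonneg (fun _ _ => by positivity)).mp h3 x (Finset.mem_univ x)
  simpa using this

theorem sum_charDist {f : Fn n} (hf : f ≠ 0) : ∑ v, charDist f v = 1 := by
  have hN := l2Norm_ne_zero hf
  simp only [charDist]
  rw [← Finset.sum_div, Fintype.sum_prod_type]
  simp only [parseval]
  have hcard : ((Finset.univ : Finset (Vec n)).card : ℝ) = 2 ^ n := by simp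
  have key : ∑ a : Vec n, 𝔼 x, ‖mulDeriv a f x‖ ^ 2 = 2 ^ n * l2Norm f ^ 4 := by
    have h4 : l2Norm f ^ 4 = (l2Norm f ^ 2) * (l2Norm f ^ 2) := by ring
    rw [h4, l2Norm_sq]
    simp only [Finset.expect_eq_sum_div_card, hcard, mulDeriv, norm_mul, RCLike.norm_conj, mul_pow]
    rw [← Finset.sum_div, Finset.sum_comm]
    have e : ∀ x : Vec n, ∑ a, ‖f (x + a)‖ ^ 2 * ‖f x‖ ^ 2 = (∑ y, ‖f y‖ ^ 2) * ‖f x‖ ^ 2 := by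
      intro x
      rw [← Finset.sum_mul]
      congr 1
      exact Fintype.sum_equiv (Equiv.addLeft x) _ _ fun _ => rfl
    simp only [e]
    rw [← Finset.mul_sum]
    field_simp
  rw [key]
  exact div_self (by positivity)

theorem charDist_nonneg (f : Fn n) (v : Phase n) : 0 ≤ charDist f v := by
  unfold charDist
  positivity

theorem convDist_nonneg (f : Fn n) (v : Phase n) : 0 ≤ convDist f v :=
  Finset.sum_nonneg fun _ _ => mul_nonneg (charDist_nonneg _ _) (charDist_nonneg _ _)

theorem sum_convDist {f : Fn n} (hf : f ≠ 0) : ∑ v, convDist f v = 1 := by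
  simp only [convDist]
  rw [Finset.sum_comm]
  have e : ∀ w : Phase n, ∑ v, charDist f w * charDist f (v - w) = charDist f w := by
    intro w
    rw [← Finset.mul_sum]
    have : ∑ v, charDist f (v - w) = ∑ v, charDist f v :=
      Fintype.sum_equiv (Equiv.subRight w) _ _ fun _ => rfl
    rw [this, sum_charDist hf, mul_one]
  simp only [e, sum_charDist hf]

open Classical in
/-- Sampling access to `Q_f`, for `f ≠ 0`. For `f = 0`, where `Q_f` does not exist, the sample is
`0` by convention. -/
def sampleQ (f : Fn n) : PMF (Phase n) :=
  if hf : f = 0 then PMF.pure 0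
  else PMF.ofFintype (fun v => ENNReal.ofReal (convDist f v)) (by
    rw [← ENNReal.ofReal_sum_of_nonneg fun v _ => convDist_nonneg f v, sum_convDist hf,
      ENNReal.ofReal_one])

/-! ### The sampling procedure -/

/-- `|a ∘ b|`, the number of coordinates `i` with `aᵢ = bᵢ = 1`, as a natural number. -/
def overlap (a b : Vec n) : ℕ := ∑ i, (a i * b i).val

/-- The projection `Π_{a,b}^σ f(x) = (f(x) + σ i^{|a∘b|} (-1)^{b·x} f(x + a)) / 2`. -/
def proj (v : Phase n) (σ : ℤˣ) (f : Fn n) : Fn n := fun x =>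
  (f x + ((σ : ℤ) : ℂ) * Complex.I ^ overlap v.1 v.2 * chi v.2 x * f (x + v.1)) / 2

/-- One random projection: `(a, b) ∼ Q_f`, a uniformly random sign `σ`, and `f ↦ Π_{a,b}^σ f`. -/
def boostStep (f : Fn n) : PMF (Fn n) := do
  let v ← sampleQ f
  let σ ← PMF.uniformOfFintype ℤˣ
  return proj v σ f

/-- The random function `f_k` obtained from `f_0 = f` by `k` successive random projections, the
`i`-th of which uses a sample from `Q_{f_{i-1}}`. -/
def boostChain (f : Fn n) : ℕ → PMF (Fn n)
  | 0 => PMF.pure f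
  | k + 1 => do
    let g ← boostChain f k
    boostStep g

/-- `m` independent samples from `p`. -/
def iidSamples {α : Type} (p : PMF α) : ℕ → PMF (List α)
  | 0 => PMF.pure []
  | m + 1 => do
    let x ← p
    let xs ← iidSamples p m
    return x :: xs

/-- Estimate of the Fourier coefficient of `g` at `b`: the empirical mean of `g(x) (-1)^{b·x}` over
`N` independent uniformly random points `x`. -/
def fourEst (N : ℕ) (g : Fn n) (b : Vec n) : PMF ℂ := do
  let xs ← iidSamples (PMF.uniformOfFintype (Vec n)) N
  return (xs.map fun x => g x * chi b x).sum / N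

/-- Pruning: for each listed pair `(a, b)` the coefficient `(Δₐg)^(b)` is estimated afresh from `N`
random points, and the pair is kept if the modulus of the estimate exceeds `θ`. -/
def prune (N : ℕ) (θ : ℝ) (g : Fn n) : List (Phase n) → PMF (List (Phase n))
  | [] => PMF.pure []
  | v :: S => do
    let c ← fourEst N (mulDeriv v.1 g) v.2
    let F ← prune N θ g S
    return if θ < ‖c‖ then v :: F else F

/-- The linear span over `𝔽₂` of the entries of a list. -/
def listSpan (B : List (Phase n)) : Submodule (ZMod 2) (Phase n) :=
  Submodule.span (ZMod 2) {v | v ∈ B}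

open Classical in
/-- Greedy extraction, from a list of vectors, of a basis of its span. -/
def extractBasis : List (Phase n) → List (Phase n)
  | [] => []
  | v :: l => if v ∈ listSpan (extractBasis l) then extractBasis l else v :: extractBasis l

/-- Number of samples `⌈K (n + log(1/δ)) / ε⌉`. -/
def numSamples (K : ℝ) (n : ℕ) (ε δ : ℝ) : ℕ := ⌈K * (n + Real.log (1 / δ)) / ε⌉₊

/-- Number of random points `⌈K log(m/δ) / η²⌉` used for each one of about `m` Fourier estimates
of accuracy `η`. -/
def numPoints (K : ℝ) (m : ℕ) (η δ : ℝ) : ℕ := ⌈K * Real.log (m / δ) / η ^ 2⌉₊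

/-- Robust generation. Draw `m = O((n + log(1/δ))/ε)` samples from `Q_g`; discard those pairs
`(a, b)` whose coefficient `(Δₐg)^(b)` is estimated to be at most `0.711` times the estimate `c₀` of
`‖g‖₂² = (Δ₀g)^(0)`; and return a basis of the span of the remaining pairs.
Here `κ` is a promised lower bound for `‖g‖₂²`, all estimates have accuracy of order `κ`, and `K`
is the constant hidden in the `O`-notation. -/
def robustGenerate (K ε δ κ : ℝ) (g : Fn n) : PMF (List (Phase n)) := do
  let m := numSamples K n ε δ
  let N := numPoints K m (κ / 1000) δ
  let S ← iidSamples (sampleQ g) m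
  let c₀ ← fourEst N (mulDeriv 0 g) 0
  let F ← prune N (0.711 * ‖c₀‖) g S
  return extractBasis F

/-- The number of rounds `t = ⌈log_{1.08}(1/τ)⌉`. -/
def numRounds (τ : ℝ) : ℕ := ⌈Real.logb 1.08 (1 / τ)⌉₊

/-- The algorithm `LagrangianSample(f, γ, τ)`, as the law of its random output. A uniformly random
`s ∈ {0, …, t}` is drawn, `f_s` is generated, and robust generation with parameters
`ε = (γ - 1/2)² τ⁸ / 8` and `δ = 1/2` is applied to `f_s` (with the promise `‖f_s‖₂² ≥ τ²`). The
functions `f_{s+1}, …, f_t` are not generated, since the output does not depend on them. -/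
def LagrangianSample (K : ℝ) (f : Fn n) (γ τ : ℝ) : PMF (List (Phase n)) := do
  let s ← PMF.uniformOfFintype (Fin (numRounds τ + 1))
  let g ← boostChain f s
  robustGenerate K ((γ - 1 / 2) ^ 2 * τ ^ 8 / 8) (1 / 2) (τ ^ 2) g

end StabSampling

end

open scoped BigOperators ComplexConjugate

noncomputable section

namespace StabSampling

variable {n : ℕ}

/-! ### Elementary facts about `𝔽₂ⁿ` and characters -/

theorem vec_add_self (x : Vec n) : x + x = 0 := funext fun i => CharTwo.add_self_eq_zero (x i)

theorem phase_add_self (v : Phase n) : v + v = 0 :=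
  Prod.ext (vec_add_self v.1) (vec_add_self v.2)

theorem phase_neg (v : Phase n) : -v = v := (eq_neg_of_add_eq_zero_left (phase_add_self v)).symm

theorem phase_sub (v w : Phase n) : v - w = v + w := by rw [sub_eq_add_neg, phase_neg]

theorem phase_add_add_self (v w : Phase n) : v + w + w = v := by
  rw [add_assoc, phase_add_self, add_zero]

theorem chi_comm (b x : Vec n) : chi b x = chi x b := by
  simp only [chi, dotProduct_comm]

theorem chi_add_right (b x y : Vec n) : chi b (x + y) = chi b x * chi b y := (chi_mul b x y).symm

theorem chi_add_left (b c x : Vec n) : chi (b + c) x = chi b x * chi c x := by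
  rw [chi_comm, chi_add_right, chi_comm x, chi_comm x]

theorem chi_eq_one_or (b x : Vec n) : chi b x = 1 ∨ chi b x = -1 := neg_one_pow_eq_or ℂ _

theorem chi_mul_self (b x : Vec n) : chi b x * chi b x = 1 := by
  rcases chi_eq_one_or b x with h | h <;> simp [h]

theorem norm_chi (b x : Vec n) : ‖chi b x‖ = 1 := by
  rcases chi_eq_one_or b x with h | h <;> simp [h]

theorem chi_zero_right (b : Vec n) : chi b 0 = 1 := by simp [chi]

theorem chi_zero_left (x : Vec n) : chi 0 x = 1 := by simp [chi]

theorem chi_eq_neg_one_pow_overlap (a b : Vec n) : chi b a = (-1) ^ overlap a b := by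
  rw [chi_comm, chi_eq_prod, overlap, Finset.prod_pow_eq_pow_sum]

theorem expect_eq (F : Vec n → ℂ) : 𝔼 x, F x = (∑ x, F x) / 2 ^ n := by
  simp [Finset.expect_eq_sum_div_card]

theorem expect_eq_real (F : Vec n → ℝ) : 𝔼 x, F x = (∑ x, F x) / 2 ^ n := by
  simp [Finset.expect_eq_sum_div_card]

theorem sum_translate {M : Type*} [AddCommMonoid M] (a : Vec n) (F : Vec n → M) :
    ∑ x, F (x + a) = ∑ x, F x :=
  Fintype.sum_equiv (Equiv.addRight a) _ _ fun _ => rfl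

theorem vec_add_add_self (x a : Vec n) : x + a + a = x := by
  rw [add_assoc, vec_add_self, add_zero]

theorem expect_translate (a : Vec n) (F : Vec n → ℂ) : 𝔼 x, F (x + a) = 𝔼 x, F x := by
  rw [expect_eq, expect_eq, sum_translate]

/-! ### The inner product -/

theorem ip_add_left (f g h : Fn n) : ip (f + g) h = ip f h + ip g h := by
  simp [ip, add_mul, Finset.expect_add_distrib]

theorem ip_smul_left (c : ℂ) (f g : Fn n) : ip (c • f) g = c * ip f g := by
  simp [ip, mul_assoc, Finset.mul_expect]

theorem conj_ip (f g : Fn n) : conj (ip f g) = ip g f := by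
  simp [ip, expect_eq, mul_comm, Complex.conj_ofNat]

theorem ip_add_right (f g h : Fn n) : ip f (g + h) = ip f g + ip f h := by
  rw [← conj_ip, ip_add_left, map_add, conj_ip, conj_ip]

theorem ip_smul_right (c : ℂ) (f g : Fn n) : ip f (c • g) = conj c * ip f g := by
  rw [← conj_ip, ip_smul_left, map_mul, conj_ip]

theorem ip_neg_left (f g : Fn n) : ip (-f) g = -ip f g := by
  simpa using ip_smul_left (-1) f g

theorem ip_sub_left (f g h : Fn n) : ip (f - g) h = ip f h - ip g h := by
  rw [sub_eq_add_neg, ip_add_left, ip_neg_left, sub_eq_add_neg]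

theorem ip_neg_right (f g : Fn n) : ip f (-g) = -ip f g := by
  simpa using ip_smul_right (-1) f g

theorem ip_sub_right (f g h : Fn n) : ip f (g - h) = ip f g - ip f h := by
  rw [sub_eq_add_neg, ip_add_right, ip_neg_right, sub_eq_add_neg]

theorem ip_self (f : Fn n) : ip f f = ((l2Norm f ^ 2 : ℝ) : ℂ) := by
  rw [l2Norm_sq, ip, expect_eq, expect_eq_real]
  push_cast
  congr 1
  refine Finset.sum_congr rfl fun x _ => ?_
  rw [Complex.mul_conj, Complex.normSq_eq_norm_sq]
  push_cast
  rfl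

theorem norm_ip_sq_le (f g : Fn n) : ‖ip f g‖ ^ 2 ≤ l2Norm f ^ 2 * l2Norm g ^ 2 := by
  have h1 : ‖ip f g‖ ≤ (∑ x, ‖f x‖ * ‖g x‖) / 2 ^ n := by
    rw [ip, expect_eq, norm_div, norm_pow, Complex.norm_ofNat]
    gcongr
    refine (norm_sum_le _ _).trans (le_of_eq (Finset.sum_congr rfl fun x _ => ?_))
    simp
  rw [l2Norm_sq, l2Norm_sq, expect_eq_real, expect_eq_real, div_mul_div_comm]
  calc ‖ip f g‖ ^ 2 ≤ ((∑ x, ‖f x‖ * ‖g x‖) / 2 ^ n) ^ 2 := by gcongr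
    _ = (∑ x, ‖f x‖ * ‖g x‖) ^ 2 / (2 ^ n * 2 ^ n) := by ring
    _ ≤ _ := by
      gcongr
      exact Finset.sum_mul_sq_le_sq_mul_sq _ _ _

theorem l2Norm_nonneg (f : Fn n) : 0 ≤ l2Norm f := Real.sqrt_nonneg _

theorem norm_ip_le (f g : Fn n) : ‖ip f g‖ ≤ l2Norm f * l2Norm g := by
  rw [← sq_le_sq₀ (norm_nonneg _) (mul_nonneg (l2Norm_nonneg f) (l2Norm_nonneg g)), mul_pow]
  exact norm_ip_sq_le f g

/-! ### Weyl operators -/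

/-- The Weyl operator `f ↦ i^{|a∘b|} (-1)^{b·x} f(x + a)`. -/
def weyl (v : Phase n) (f : Fn n) : Fn n :=
  fun x => Complex.I ^ overlap v.1 v.2 * chi v.2 x * f (x + v.1)

/-- The commutation sign `(-1)^{[v, w]}` of two Weyl operators. -/
def comSign (v w : Phase n) : ℂ := chi w.2 v.1 * chi v.2 w.1

theorem comSign_comm (v w : Phase n) : comSign v w = comSign w v := mul_comm _ _

theorem comSign_add_left (u v w : Phase n) : comSign (u + v) w = comSign u w * comSign v w := by
  simp only [comSign, Prod.fst_add, Prod.snd_add, chi_add_left, chi_add_right]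
  ring

theorem comSign_eq_one_or (v w : Phase n) : comSign v w = 1 ∨ comSign v w = -1 := by
  rcases chi_eq_one_or w.2 v.1 with h | h <;> rcases chi_eq_one_or v.2 w.1 with h' | h' <;>
    simp [comSign, h, h']

theorem comSign_self (v : Phase n) : comSign v v = 1 := chi_mul_self _ _

theorem comSign_zero_left (v : Phase n) : comSign 0 v = 1 := by
  simp [comSign, chi_zero_left, chi_zero_right]

theorem conj_comSign (v w : Phase n) : conj (comSign v w) = comSign v w := by
  rcases comSign_eq_one_or v w with h | h <;> simp [h]

theorem weyl_add (v : Phase n) (f g : Fn n) : weyl v (f + g) = weyl v f + weyl v g := by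
  funext x; simp [weyl, mul_add]

theorem weyl_smul (v : Phase n) (c : ℂ) (f : Fn n) : weyl v (c • f) = c • weyl v f := by
  funext x; simp only [weyl, Pi.smul_apply, smul_eq_mul]; ring

theorem weyl_weyl_self (v : Phase n) (f : Fn n) : weyl v (weyl v f) = f := by
  funext x
  simp only [weyl, vec_add_add_self, chi_add_right]
  have h1 : Complex.I ^ overlap v.1 v.2 * Complex.I ^ overlap v.1 v.2 * chi v.2 v.1 = 1 := by
    rw [chi_eq_neg_one_pow_overlap, ← mul_pow, Complex.I_mul_I, ← mul_pow]
    simp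
  linear_combination (f x * chi v.2 x * chi v.2 x) * h1 + f x * chi_mul_self v.2 x

theorem weyl_comm (v w : Phase n) (f : Fn n) :
    weyl v (weyl w f) = comSign v w • weyl w (weyl v f) := by
  funext x
  simp only [weyl, comSign, chi_add_right, Pi.smul_apply, smul_eq_mul, add_right_comm x w.1 v.1]
  linear_combination (-(Complex.I ^ overlap v.1 v.2 * chi v.2 x * Complex.I ^ overlap w.1 w.2 *
    chi w.2 x * chi w.2 v.1 * f (x + v.1 + w.1))) * chi_mul_self v.2 w.1

theorem exists_weyl_weyl (v w : Phase n) :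
    ∃ c : ℂ, ‖c‖ = 1 ∧ ∀ f : Fn n, weyl v (weyl w f) = c • weyl (v + w) f := by
  have hI : ∀ k : ℕ, Complex.I ^ k ≠ 0 := fun k => pow_ne_zero _ Complex.I_ne_zero
  refine ⟨Complex.I ^ overlap v.1 v.2 * Complex.I ^ overlap w.1 w.2 * chi w.2 v.1 /
    Complex.I ^ overlap (v + w).1 (v + w).2, by simp [norm_chi], fun f => ?_⟩
  funext x
  simp only [weyl, chi_add_right, Pi.smul_apply, smul_eq_mul, chi_add_left, Prod.snd_add,
    Prod.fst_add, ← add_assoc x]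
  field_simp [hI]

theorem ip_weyl_left (v : Phase n) (f g : Fn n) : ip (weyl v f) g = ip f (weyl v g) := by
  have h1 : Complex.I ^ overlap v.1 v.2 * chi v.2 v.1 = conj (Complex.I ^ overlap v.1 v.2) := by
    rw [chi_eq_neg_one_pow_overlap, ← mul_pow, map_pow, Complex.conj_I]
    simp
  rw [ip, ip, ← expect_translate v.1]
  refine Finset.expect_congr rfl fun x _ => ?_
  simp only [weyl, map_mul, conj_chi, vec_add_add_self, chi_add_right, ← h1]
  ring

theorem ip_weyl_weyl (v : Phase n) (f g : Fn n) : ip (weyl v f) (weyl v g) = ip f g := by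
  rw [ip_weyl_left, weyl_weyl_self]

theorem l2Norm_weyl (v : Phase n) (f : Fn n) : l2Norm (weyl v f) ^ 2 = l2Norm f ^ 2 := by
  have h := ip_weyl_weyl v f f
  rw [ip_self, ip_self] at h
  exact_mod_cast h

theorem conj_ip_weyl (v : Phase n) (f : Fn n) : conj (ip (weyl v f) f) = ip (weyl v f) f := by
  rw [conj_ip, ip_weyl_left]

theorem norm_fourier_mulDeriv (v : Phase n) (f : Fn n) :
    ‖fourier (mulDeriv v.1 f) v.2‖ = ‖ip (weyl v f) f‖ := by
  have : ip (weyl v f) f = Complex.I ^ overlap v.1 v.2 * fourier (mulDeriv v.1 f) v.2 := by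
    rw [ip, fourier, Finset.mul_expect]
    refine Finset.expect_congr rfl fun x _ => ?_
    simp only [weyl, mulDeriv]
    ring
  simp [this]

theorem weyl_zero (f : Fn n) : weyl 0 f = f := by
  funext x
  simp [weyl, overlap, chi_zero_left]

theorem fourier_mul_conj_sum (f g : Fn n) :
    ∑ b, fourier f b * conj (fourier g b) = ip f g := by
  have e : ∀ b : Vec n, fourier f b * conj (fourier g b) =
      (∑ x, ∑ y, f x * conj (g y) * chi b (x + y)) / ((2 : ℂ) ^ n * 2 ^ n) := by
    intro b
    rw [fourier, fourier, expect_eq, expect_eq, map_div₀, map_sum, div_mul_div_comm,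
      Finset.sum_mul_sum]
    simp only [map_mul, conj_chi, map_pow, Complex.conj_ofNat]
    congr 1
    refine Finset.sum_congr rfl fun x _ => Finset.sum_congr rfl fun y _ => ?_
    rw [← chi_mul]
    ring
  have e2 : ∀ x : Vec n, ∑ b, ∑ y, f x * conj (g y) * chi b (x + y)
      = f x * conj (g x) * 2 ^ n := by
    intro x
    rw [Finset.sum_comm]
    simp only [← Finset.mul_sum, sum_chi]
    rw [Finset.sum_eq_single x]
    · simp [vec_add_self]
    · intro y _ hy
      have : x + y ≠ 0 := fun h0 => hy (by
        have := congrArg (· + y) h0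
        simpa [vec_add_add_self] using this.symm)
      simp [this]
    · simp
  simp only [e]
  rw [← Finset.sum_div, Finset.sum_comm]
  simp only [e2]
  rw [← Finset.sum_mul, ip, expect_eq]
  field_simp

/-- Moyal's identity. -/
theorem moyal (f₁ f₂ f₃ f₄ : Fn n) :
    ∑ v, ip (weyl v f₁) f₂ * conj (ip (weyl v f₃) f₄) =
      2 ^ n * (ip f₁ f₃ * conj (ip f₂ f₄)) := by
  have hI : ∀ k : ℕ, Complex.I ^ k * conj (Complex.I ^ k) = 1 := by
    intro k
    rw [map_pow, ← mul_pow]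
    simp
  have e : ∀ (v : Phase n) (f g : Fn n), ip (weyl v f) g =
      Complex.I ^ overlap v.1 v.2 * fourier (fun x => f (x + v.1) * conj (g x)) v.2 := by
    intro v f g
    rw [ip, fourier, Finset.mul_expect]
    refine Finset.expect_congr rfl fun x _ => ?_
    simp only [weyl]
    ring
  have e1 : ∀ v : Phase n, ip (weyl v f₁) f₂ * conj (ip (weyl v f₃) f₄) =
      fourier (fun x => f₁ (x + v.1) * conj (f₂ x)) v.2 *
        conj (fourier (fun x => f₃ (x + v.1) * conj (f₄ x)) v.2) := by
    intro v
    rw [e, e, map_mul]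
    linear_combination (fourier (fun x => f₁ (x + v.1) * conj (f₂ x)) v.2 *
        conj (fourier (fun x => f₃ (x + v.1) * conj (f₄ x)) v.2)) * hI (overlap v.1 v.2)
  simp only [e1]
  rw [Fintype.sum_prod_type]
  simp only [fourier_mul_conj_sum]
  simp only [ip, expect_eq]
  rw [← Finset.sum_div, Finset.sum_comm]
  have e3 : ∀ x : Vec n, ∑ a, f₁ (x + a) * conj (f₂ x) * conj (f₃ (x + a) * conj (f₄ x)) =
      (∑ y, f₁ y * conj (f₃ y)) * (conj (f₂ x) * f₄ x) := by
    intro x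
    rw [← sum_translate x, Finset.sum_mul]
    refine Finset.sum_congr rfl fun a _ => ?_
    rw [add_comm a x, ← add_assoc, vec_add_self, zero_add, map_mul, Complex.conj_conj]
    ring
  simp only [e3]
  rw [← Finset.mul_sum, map_div₀, map_sum]
  simp only [map_mul, Complex.conj_conj, map_pow, Complex.conj_ofNat]
  field_simp

/-! ### Squared Weyl correlations -/

/-- The squared modulus of `⟨W_v f, f⟩`. -/
def weylSq (f : Fn n) (v : Phase n) : ℝ := ‖ip (weyl v f) f‖ ^ 2

/-- The commutation sign as a real number. -/
def realSign (v w : Phase n) : ℝ := (comSign v w).re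

theorem realSign_eq_one_or (v w : Phase n) : realSign v w = 1 ∨ realSign v w = -1 := by
  rcases comSign_eq_one_or v w with h | h <;> simp [realSign, h]

theorem comSign_eq_ofReal (v w : Phase n) : comSign v w = (realSign v w : ℂ) := by
  rcases comSign_eq_one_or v w with h | h <;> simp [realSign, h]

theorem realSign_comm (v w : Phase n) : realSign v w = realSign w v := by
  rw [realSign, comSign_comm, realSign]

theorem realSign_add_left (u v w : Phase n) :
    realSign (u + v) w = realSign u w * realSign v w := by
  have := comSign_add_left u v w
  simp only [comSign_eq_ofReal] at this
  exact_mod_cast this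

theorem realSign_add_right (u v w : Phase n) :
    realSign u (v + w) = realSign u v * realSign u w := by
  rw [realSign_comm, realSign_add_left, realSign_comm v, realSign_comm w]

theorem realSign_self (v : Phase n) : realSign v v = 1 := by simp [realSign, comSign_self]

theorem realSign_zero_left (v : Phase n) : realSign 0 v = 1 := by
  simp [realSign, comSign_zero_left]

theorem weylSq_nonneg (f : Fn n) (v : Phase n) : 0 ≤ weylSq f v := sq_nonneg _

theorem charDist_eq (f : Fn n) (v : Phase n) :
    charDist f v = weylSq f v / (2 ^ n * l2Norm f ^ 4) := by
  rw [charDist, weylSq, norm_fourier_mulDeriv]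

theorem weylSq_add (f : Fn n) (v w : Phase n) :
    weylSq f (v + w) = ‖ip (weyl v (weyl w f)) f‖ ^ 2 := by
  obtain ⟨c, hc, h⟩ := exists_weyl_weyl (n := n) v w
  rw [h, ip_smul_left, norm_mul, hc, one_mul, weylSq]

theorem ofReal_weylSq (f : Fn n) (v : Phase n) :
    (weylSq f v : ℂ) = ip (weyl v f) f * conj (ip (weyl v f) f) := by
  rw [Complex.mul_conj, Complex.normSq_eq_norm_sq, weylSq]

/-- The squared Weyl correlations are, up to scaling, their own symplectic Fourier transform. -/
theorem sum_weylSq_mul_realSign (f : Fn n) (w : Phase n) :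
    ∑ v, weylSq f v * realSign v w = 2 ^ n * weylSq f w := by
  have h := moyal f f (weyl w f) (weyl w f)
  have e : ∀ v : Phase n, ip (weyl v f) f * conj (ip (weyl v (weyl w f)) (weyl w f)) =
      ((weylSq f v * realSign v w : ℝ) : ℂ) := by
    intro v
    rw [weyl_comm, ip_smul_left, ip_weyl_weyl, map_mul, conj_comSign, comSign_eq_ofReal]
    push_cast
    rw [ofReal_weylSq]
    ring
  simp only [e] at h
  have e2 : ip f (weyl w f) * conj (ip f (weyl w f)) = (weylSq f w : ℂ) := by
    rw [ofReal_weylSq, ip_weyl_left]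
  rw [e2] at h
  exact_mod_cast h

theorem weylSq_zero (f : Fn n) : weylSq f 0 = l2Norm f ^ 4 := by
  rw [weylSq, weyl_zero, ip_self, Complex.norm_real, Real.norm_eq_abs, sq_abs]
  ring

theorem sum_weylSq (f : Fn n) : ∑ v, weylSq f v = 2 ^ n * l2Norm f ^ 4 := by
  have h := sum_weylSq_mul_realSign f 0
  simpa [realSign_comm _ (0 : Phase n), realSign_zero_left, weylSq_zero] using h

theorem weylSq_le (f : Fn n) (v : Phase n) : weylSq f v ≤ l2Norm f ^ 4 := by
  rw [weylSq]
  refine (norm_ip_sq_le _ _).trans (le_of_eq ?_)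
  rw [l2Norm_weyl]
  ring

/-- Two anticommuting Weyl operators cannot both have large correlation. -/
theorem weylSq_add_weylSq_le {f : Fn n} {v w : Phase n} (h : realSign v w = -1) :
    weylSq f v + weylSq f w ≤ l2Norm f ^ 4 := by
  set a := ip (weyl v f) f with ha
  set b := ip (weyl w f) f with hb
  have hca : conj a = a := conj_ip_weyl v f
  have hcb : conj b = b := conj_ip_weyl w f
  have hs : comSign v w = -1 := by rw [comSign_eq_ofReal, h]; simp
  set k := a • weyl v f + b • weyl w f with hk
  have h1 : ip k f = ((weylSq f v + weylSq f w : ℝ) : ℂ) := by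
    rw [hk, ip_add_left, ip_smul_left, ip_smul_left]
    push_cast
    rw [ofReal_weylSq, ofReal_weylSq, ← ha, ← hb, hca, hcb]
  have h2 : ip (weyl v f) (weyl w f) + ip (weyl w f) (weyl v f) = 0 := by
    rw [ip_weyl_left, ip_weyl_left w, ← ip_add_right, weyl_comm, hs]
    simp [ip]
  have h3 : ip k k = (((weylSq f v + weylSq f w) * l2Norm f ^ 2 : ℝ) : ℂ) := by
    rw [hk]
    simp only [ip_add_left, ip_smul_left, ip_add_right, ip_smul_right, hca, hcb, ip_weyl_weyl,
      ip_self f]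
    push_cast
    rw [ofReal_weylSq, ofReal_weylSq, ← ha, ← hb, hca, hcb]
    linear_combination (a * b) * h2
  have h4 := norm_ip_sq_le k f
  rw [ip_self] at h3
  have h3' : l2Norm k ^ 2 = (weylSq f v + weylSq f w) * l2Norm f ^ 2 := by exact_mod_cast h3
  rw [h1, h3', Complex.norm_real, Real.norm_eq_abs, sq_abs] at h4
  by_contra hcon
  push Not at hcon
  have h5 : 0 ≤ l2Norm f ^ 4 := by positivity
  nlinarith

/-! ### The `U³`-norm in terms of Weyl correlations -/

theorem expect_comm' (F : Vec n → Vec n → ℂ) : 𝔼 x, 𝔼 y, F x y = 𝔼 y, 𝔼 x, F x y := by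
  exact Finset.expect_comm _ _ _

theorem expect_mulDeriv_mulDeriv (h : Fn n) :
    𝔼 x : Vec n, 𝔼 a : Vec n, 𝔼 b : Vec n, mulDeriv a (mulDeriv b h) x =
      ((∑ b, ‖fourier h b‖ ^ 4 : ℝ) : ℂ) := by
  set k : Fn n := fun y => 𝔼 x, mulDeriv y h x with hk
  have h1 : 𝔼 x : Vec n, 𝔼 a : Vec n, 𝔼 b : Vec n, mulDeriv a (mulDeriv b h) x = ip k k := by
    have : ∀ x : Vec n, 𝔼 a : Vec n, 𝔼 b : Vec n, mulDeriv a (mulDeriv b h) x =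
        𝔼 b, k b * conj (mulDeriv b h x) := by
      intro x
      rw [expect_comm']
      refine Finset.expect_congr rfl fun b _ => ?_
      rw [hk, Finset.expect_mul, ← expect_translate x]
      refine Finset.expect_congr rfl fun a _ => ?_
      simp only [mulDeriv, add_comm a x, ← add_assoc, vec_add_self, zero_add]
    simp only [this]
    rw [expect_comm', ip]
    refine Finset.expect_congr rfl fun b _ => ?_
    rw [← Finset.mul_expect, hk]
    simp only [expect_eq, map_div₀, map_sum, map_pow, Complex.conj_ofNat]
  have h2 : ∀ b, fourier k b = fourier h b * conj (fourier h b) := by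
    intro b
    have e1 : conj (fourier h b) = 𝔼 x, conj (h x) * chi b x := by
      simp only [fourier, expect_eq, map_div₀, map_sum, map_pow, Complex.conj_ofNat, map_mul,
        conj_chi]
    rw [e1, Finset.mul_expect, fourier]
    simp only [hk, Finset.expect_mul]
    rw [expect_comm']
    refine Finset.expect_congr rfl fun x _ => ?_
    rw [fourier, Finset.expect_mul, ← expect_translate x (fun y => h y * chi b y * _)]
    refine Finset.expect_congr rfl fun y _ => ?_
    simp only [mulDeriv, chi_add_right, add_comm y x]
    linear_combination (-(h (x + y) * conj (h x) * chi b y)) * chi_mul_self b x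
  rw [h1, ← fourier_mul_conj_sum]
  push_cast
  refine Finset.sum_congr rfl fun b _ => ?_
  rw [h2, map_mul, Complex.conj_conj]
  have := Complex.mul_conj (fourier h b)
  rw [Complex.normSq_eq_norm_sq] at this
  push_cast at this
  linear_combination (fourier h b * conj (fourier h b) + (‖fourier h b‖ : ℂ) ^ 2) * this

theorem u3Norm_eq (f : Fn n) : u3Norm f = ((∑ v, weylSq f v ^ 2) / 2 ^ n) ^ (1 / 8 : ℝ) := by
  have h : 𝔼 x : Vec n, 𝔼 a : Vec n, 𝔼 b : Vec n, 𝔼 c : Vec n,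
      mulDeriv a (mulDeriv b (mulDeriv c f)) x = (((∑ v, weylSq f v ^ 2) / 2 ^ n : ℝ) : ℂ) := by
    have e : ∀ x : Vec n, 𝔼 a : Vec n, 𝔼 b : Vec n, 𝔼 c : Vec n,
        mulDeriv a (mulDeriv b (mulDeriv c f)) x = 𝔼 c : Vec n, 𝔼 a : Vec n, 𝔼 b : Vec n,
          mulDeriv a (mulDeriv b (mulDeriv c f)) x := by
      intro x
      rw [expect_comm' (fun c a => 𝔼 b : Vec n, mulDeriv a (mulDeriv b (mulDeriv c f)) x)]
      exact Finset.expect_congr rfl fun a _ => expect_comm' _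
    simp only [e]
    rw [expect_comm']
    simp only [expect_mulDeriv_mulDeriv]
    rw [expect_eq, Fintype.sum_prod_type]
    push_cast
    congr 1
    refine Finset.sum_congr rfl fun a _ => Finset.sum_congr rfl fun b _ => ?_
    rw [weylSq, ← norm_fourier_mulDeriv]
    push_cast
    ring
  rw [u3Norm, h, Complex.norm_real, Real.norm_of_nonneg]
  exact div_nonneg (Finset.sum_nonneg fun _ _ => sq_nonneg _) (by positivity)

/-! ### Stabilizer states and their Lagrangians -/

theorem isStabilizerState_iff (φ : Fn n) :
    IsStabilizerState φ ↔ l2Norm φ = 1 ∧ ∀ v, weylSq φ v = 0 ∨ weylSq φ v = 1 := by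
  rw [IsStabilizerState]
  refine and_congr_right fun h1 => ?_
  have hs : ∑ v, weylSq φ v = 2 ^ n := by rw [sum_weylSq, h1]; simp
  have hle : ∀ v, weylSq φ v ≤ 1 := fun v => by simpa [h1] using weylSq_le φ v
  have h0 := weylSq_nonneg φ
  have h2 : u3Norm φ = 1 ↔ ∑ v, weylSq φ v ^ 2 = 2 ^ n := by
    have hnn : 0 ≤ (∑ v, weylSq φ v ^ 2) / 2 ^ n :=
      div_nonneg (Finset.sum_nonneg fun _ _ => sq_nonneg _) (by positivity)
    have h3 := Real.rpow_left_inj hnn zero_le_one (by norm_num : (1 / 8 : ℝ) ≠ 0)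
    rw [Real.one_rpow] at h3
    rw [u3Norm_eq, h3, div_eq_one_iff_eq (by positivity)]
  rw [h2]
  constructor
  · intro h v
    have h3 : ∑ v, (weylSq φ v - weylSq φ v ^ 2) = 0 := by
      rw [Finset.sum_sub_distrib, hs, h, sub_self]
    have h4 := (Finset.sum_eq_zero_iff_of_nonneg (fun v _ => by nlinarith [h0 v, hle v])).mp h3 v
      (Finset.mem_univ v)
    have h5 : weylSq φ v * (1 - weylSq φ v) = 0 := by linarith
    rcases mul_eq_zero.mp h5 with h6 | h6
    · exact Or.inl h6
    · exact Or.inr (by linarith)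
  · intro h
    rw [← hs]
    refine Finset.sum_congr rfl fun v _ => ?_
    rcases h v with h3 | h3 <;> simp [h3]

theorem mem_lagrangian_iff (φ : Fn n) (v : Phase n) : v ∈ lagrangian φ ↔ weylSq φ v = 1 := by
  rw [lagrangian, Set.mem_ofPred_eq, norm_fourier_mulDeriv, weylSq]
  constructor
  · intro h; simp [h]
  · intro h
    exact (pow_eq_one_iff_of_nonneg (norm_nonneg _) two_ne_zero).mp h

namespace IsStabilizerState

variable {φ : Fn n} (hφ : IsStabilizerState φ)
include hφ

theorem weylSq_eq (v : Phase n) : weylSq φ v = 0 ∨ weylSq φ v = 1 :=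
  ((isStabilizerState_iff φ).mp hφ).2 v

theorem ip_self_eq_one : ip φ φ = 1 := by rw [ip_self, hφ.1]; simp

theorem weylSq_eq_zero {v : Phase n} (hv : v ∉ lagrangian φ) : weylSq φ v = 0 :=
  (hφ.weylSq_eq v).resolve_right fun h => hv ((mem_lagrangian_iff φ v).mpr h)

theorem ip_weyl_eq_zero {v : Phase n} (hv : v ∉ lagrangian φ) : ip (weyl v φ) φ = 0 := by
  have := hφ.weylSq_eq_zero hv
  simpa [weylSq] using this

theorem ne_zero : φ ≠ 0 := by
  rintro rfl
  have := hφ.ip_self_eq_one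
  simp [ip] at this

/-- A stabilizer state is a joint eigenvector of the Weyl operators of its Lagrangian. -/
theorem exists_sign {v : Phase n} (hv : v ∈ lagrangian φ) :
    ∃ σ : ℤˣ, weyl v φ = ((σ : ℤ) : ℂ) • φ := by
  rw [mem_lagrangian_iff, weylSq] at hv
  have hn : ‖ip (weyl v φ) φ‖ = 1 := (pow_eq_one_iff_of_nonneg (norm_nonneg _) two_ne_zero).mp hv
  have hc := conj_ip_weyl v φ
  set s := ip (weyl v φ) φ with hs
  have hss : s * s = 1 := by
    nth_rewrite 2 [← hc]
    rw [Complex.mul_conj, Complex.normSq_eq_norm_sq, hn]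
    simp
  have h0 : ip (weyl v φ - s • φ) (weyl v φ - s • φ) = 0 := by
    simp only [ip_sub_left, ip_sub_right, ip_smul_left, ip_smul_right, hc, ip_weyl_weyl,
      hφ.ip_self_eq_one, ← hs]
    have : ip φ (weyl v φ) = s := by rw [← ip_weyl_left]
    rw [this]
    linear_combination -hss
  have h1 : weyl v φ = s • φ := by
    by_contra hne
    have h2 := l2Norm_ne_zero (sub_ne_zero.mpr hne)
    rw [ip_self] at h0
    exact h2 (by simpa using h0)
  rcases mul_self_eq_one_iff.mp hss with h | h
  · exact ⟨1, by rw [h1, h]; simp⟩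
  · exact ⟨-1, by rw [h1, h]; simp⟩

theorem weylSq_add_of_mem {v : Phase n} (hv : v ∈ lagrangian φ) (w : Phase n) :
    weylSq φ (v + w) = weylSq φ w := by
  obtain ⟨σ, hσ⟩ := hφ.exists_sign hv
  rw [weylSq_add, ip_weyl_left, hσ, ip_smul_right, weylSq, norm_mul]
  rcases Int.units_eq_one_or σ with rfl | rfl <;> simp

theorem zero_mem : (0 : Phase n) ∈ lagrangian φ := by
  rw [mem_lagrangian_iff, weylSq_zero, hφ.1]; simp

theorem add_mem {v w : Phase n} (hv : v ∈ lagrangian φ) (hw : w ∈ lagrangian φ) :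
    v + w ∈ lagrangian φ := by
  rw [mem_lagrangian_iff, hφ.weylSq_add_of_mem hv, ← mem_lagrangian_iff]
  exact hw

/-- The Lagrangian of a stabilizer state as a subspace. -/
def lagrangianSubmodule : Submodule (ZMod 2) (Phase n) where
  carrier := lagrangian φ
  add_mem' := hφ.add_mem
  zero_mem' := hφ.zero_mem
  smul_mem' := by
    intro c v hv
    have hc : ∀ c : ZMod 2, c = 0 ∨ c = 1 := by decide
    rcases hc c with rfl | rfl
    · rw [zero_smul]; exact hφ.zero_mem
    · rwa [one_smul]

theorem sum_weylSq_eq : ∑ v, weylSq φ v = 2 ^ n := by rw [sum_weylSq, hφ.1]; simp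

theorem isotropic {v w : Phase n} (hv : v ∈ lagrangian φ) (hw : w ∈ lagrangian φ) :
    realSign v w = 1 := by
  obtain ⟨σ, hσ⟩ := hφ.exists_sign hv
  obtain ⟨ρ, hρ⟩ := hφ.exists_sign hw
  have h := weyl_comm v w φ
  rw [hσ, hρ, weyl_smul, weyl_smul, hσ, hρ, comSign_eq_ofReal] at h
  rcases realSign_eq_one_or v w with h1 | h1
  · exact h1
  · exfalso
    rw [h1] at h
    have h2 : (2 * (((ρ : ℤ) : ℂ) * ((σ : ℤ) : ℂ))) • φ = 0 := by
      have : (((ρ : ℤ) : ℂ) * ((σ : ℤ) : ℂ)) • φ = -((((ρ : ℤ) : ℂ) * ((σ : ℤ) : ℂ)) • φ) := by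
        rw [smul_smul, smul_smul] at h
        conv_lhs => rw [h]
        rw [smul_smul, ← neg_smul]
        congr 1
        push_cast
        ring
      rw [mul_smul, two_smul]
      nth_rewrite 1 [this]
      simp
    rcases smul_eq_zero.mp h2 with h3 | h3
    · rcases Int.units_eq_one_or σ with rfl | rfl <;>
        rcases Int.units_eq_one_or ρ with rfl | rfl <;> simp at h3
    · exact hφ.ne_zero h3

theorem mem_of_forall_realSign {w : Phase n} (h : ∀ v ∈ lagrangian φ, realSign v w = 1) :
    w ∈ lagrangian φ := by
  rw [mem_lagrangian_iff]
  have h1 := sum_weylSq_mul_realSign φ w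
  have h2 : ∑ v, weylSq φ v * realSign v w = ∑ v, weylSq φ v := by
    refine Finset.sum_congr rfl fun v _ => ?_
    by_cases hv : v ∈ lagrangian φ
    · rw [h v hv, mul_one]
    · rw [hφ.weylSq_eq_zero hv, zero_mul]
  rw [h2, hφ.sum_weylSq_eq] at h1
  have : (2 : ℝ) ^ n ≠ 0 := by positivity
  field_simp at h1
  exact h1.symm

theorem exists_anticommuting {u : Phase n} (hu : u ∉ lagrangian φ) :
    ∃ v ∈ lagrangian φ, realSign v u = -1 := by
  by_contra hcon
  push Not at hcon
  exact hu (hφ.mem_of_forall_realSign fun v hv =>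
    (realSign_eq_one_or v u).resolve_right (hcon v hv))

/-- The neighbours `(φ ± W_u φ)/√2` of a stabilizer state are stabilizer states. -/
theorem neighbour {u : Phase n} (hu : u ∉ lagrangian φ) {c : ℂ} (hc : c = 1 ∨ c = -1) :
    IsStabilizerState (((Real.sqrt 2)⁻¹ : ℂ) • (φ + c • weyl u φ)) ∧
      ‖ip φ (((Real.sqrt 2)⁻¹ : ℂ) • (φ + c • weyl u φ))‖ ^ 2 = 1 / 2 := by
  have hcc : conj c = c := by rcases hc with rfl | rfl <;> simp
  have hc2 : c * c = 1 := by rcases hc with rfl | rfl <;> simp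
  have hcn : ‖c‖ = 1 := by rcases hc with rfl | rfl <;> simp
  have h0 : ip (weyl u φ) φ = 0 := hφ.ip_weyl_eq_zero hu
  have h0' : ip φ (weyl u φ) = 0 := by rw [← ip_weyl_left, h0]
  have h2 : ((Real.sqrt 2 : ℂ))⁻¹ * ((Real.sqrt 2 : ℂ))⁻¹ = 1 / 2 := by
    rw [← mul_inv, ← Complex.ofReal_mul, Real.mul_self_sqrt (by norm_num)]
    norm_num
  have hcr : conj ((Real.sqrt 2 : ℂ))⁻¹ = ((Real.sqrt 2 : ℂ))⁻¹ := by
    rw [map_inv₀, Complex.conj_ofReal]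
  have hnr : ‖((Real.sqrt 2 : ℂ))⁻¹‖ ^ 2 = 1 / 2 := by
    rw [sq, ← norm_mul, h2]; norm_num
  set r := ((Real.sqrt 2 : ℂ))⁻¹ with hr
  refine ⟨?_, ?_⟩
  · rw [isStabilizerState_iff]
    constructor
    · have h1 : ip (r • (φ + c • weyl u φ)) (r • (φ + c • weyl u φ)) = 1 := by
        simp only [ip_smul_left, ip_smul_right, ip_add_left, ip_add_right, ip_weyl_weyl, h0, h0',
          hφ.ip_self_eq_one, hcr, hcc]
        linear_combination (1 + c * c) * h2 + (1 / 2) * hc2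
      rw [ip_self] at h1
      have h3 : l2Norm (r • (φ + c • weyl u φ)) ^ 2 = 1 := by exact_mod_cast h1
      exact (pow_eq_one_iff_of_nonneg (l2Norm_nonneg _) two_ne_zero).mp h3
    · intro v
      have e1 : ip (weyl v φ) (weyl u φ) = comSign v u * ip (weyl v (weyl u φ)) φ := by
        rw [← ip_weyl_left, weyl_comm u v, ip_smul_left, comSign_comm]
      have e2 : ip (weyl v (weyl u φ)) (weyl u φ) = comSign v u * ip (weyl v φ) φ := by
        rw [weyl_comm, ip_smul_left, ip_weyl_weyl]
      have e3 : ip (weyl v (r • (φ + c • weyl u φ))) (r • (φ + c • weyl u φ)) =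
          (1 + comSign v u) / 2 * (ip (weyl v φ) φ + c * ip (weyl v (weyl u φ)) φ) := by
        simp only [weyl_smul, weyl_add, ip_smul_left, ip_smul_right, ip_add_left, ip_add_right,
          e1, e2, hcr, hcc]
        linear_combination ((1 + comSign v u) * (ip (weyl v φ) φ) +
          (1 + comSign v u) * c * ip (weyl v (weyl u φ)) φ +
          comSign v u * ip (weyl v φ) φ * (c * c - 1)) * h2 +
          1 / 2 * comSign v u * ip (weyl v φ) φ * hc2
      have e4 : ‖ip (weyl v (weyl u φ)) φ‖ ^ 2 = weylSq φ (v + u) := (weylSq_add _ _ _).symm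
      have e5 : ‖ip (weyl v φ) φ‖ ^ 2 = weylSq φ v := rfl
      rw [weylSq, e3]
      rcases comSign_eq_one_or v u with hs | hs
      · rw [hs]
        norm_num only
        rw [one_mul]
        by_cases hv : v ∈ lagrangian φ
        · have h3 : ip (weyl v (weyl u φ)) φ = 0 := by
            have := hφ.weylSq_add_of_mem hv u
            rw [hφ.weylSq_eq_zero hu, ← e4] at this
            simpa using this
          rw [h3, mul_zero, add_zero, e5]
          exact hφ.weylSq_eq v
        · rw [hφ.ip_weyl_eq_zero hv, zero_add, norm_mul, hcn, one_mul, e4]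
          exact hφ.weylSq_eq _
      · rw [hs]
        left
        simp
  · rw [ip_smul_right, ip_add_right, ip_smul_right, h0', hφ.ip_self_eq_one, mul_zero, add_zero,
      mul_one, hcr, hnr]

end IsStabilizerState

theorem sum_phase_translate {M : Type*} [AddCommMonoid M] (a : Phase n) (F : Phase n → M) :
    ∑ x, F (x + a) = ∑ x, F x :=
  Fintype.sum_equiv (Equiv.addRight a) _ _ fun _ => rfl

/-- Mass, for the weights `|⟨W_v g, g⟩|²`, of the part of the coset `d + 𝓛(φ)` whose points
`d + v` satisfy `(-1)^{[v, u]} = s`, when `s = ±1`. -/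
def cosetMass (φ g : Fn n) (u d : Phase n) (s : ℝ) : ℝ :=
  ∑ v, weylSq φ v * ((1 + s * realSign v u) / 2) * weylSq g (v + d)

theorem cosetMass_relation (φ g : Fn n) (u : Phase n) :
    cosetMass φ g u 0 1 =
      cosetMass φ g u 0 (-1) + cosetMass φ g u u 1 + cosetMass φ g u u (-1) := by
  have h2 : (2 : ℝ) ^ n ≠ 0 := by positivity
  have key : 2 ^ n * cosetMass φ g u 0 1 = 2 ^ n * ((1 / 2) * ∑ w, (weylSq g w *
      (weylSq φ w + weylSq φ (u + w)))) := by
    have e : ∀ v, 2 ^ n * (weylSq φ v * ((1 + 1 * realSign v u) / 2) * weylSq g (v + 0)) =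
        ∑ w, (1 / 2) * (weylSq g w * (weylSq φ v * realSign v w +
          weylSq φ v * realSign v (u + w))) := by
      intro v
      have h := sum_weylSq_mul_realSign g v
      rw [add_zero]
      calc _ = (1 / 2) * (weylSq φ v * (1 + realSign v u)) * (2 ^ n * weylSq g v) := by ring
        _ = _ := by
          rw [← h, Finset.mul_sum]
          refine Finset.sum_congr rfl fun w _ => ?_
          rw [realSign_add_right, realSign_comm w v]
          ring
    rw [cosetMass, Finset.mul_sum, Finset.sum_congr rfl fun v _ => e v, Finset.sum_comm,
      Finset.mul_sum, Finset.mul_sum]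
    refine Finset.sum_congr rfl fun w _ => ?_
    rw [← Finset.mul_sum, ← Finset.mul_sum, Finset.sum_add_distrib, sum_weylSq_mul_realSign,
      sum_weylSq_mul_realSign]
    ring
  have h3 := mul_left_cancel₀ h2 key
  have h4 : ∑ w, weylSq g w * (weylSq φ w + weylSq φ (u + w)) = cosetMass φ g u 0 1 +
      cosetMass φ g u 0 (-1) + cosetMass φ g u u 1 + cosetMass φ g u u (-1) := by
    simp only [mul_add, cosetMass]
    rw [Finset.sum_add_distrib, ← sum_phase_translate u (fun w => weylSq g w * weylSq φ (u + w)),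
      ← Finset.sum_add_distrib, ← Finset.sum_add_distrib, ← Finset.sum_add_distrib,
      ← Finset.sum_add_distrib]
    refine Finset.sum_congr rfl fun w _ => ?_
    rw [add_comm w u, ← add_assoc, phase_add_self, zero_add, add_zero]
    ring
  rw [h4] at h3
  linarith

namespace IsStabilizerState

variable {φ : Fn n} (hφ : IsStabilizerState φ)
include hφ

theorem weylSq_add_weylSq_add_le_one {u : Phase n} (hu : u ∉ lagrangian φ) (w : Phase n) :
    weylSq φ w + weylSq φ (w + u) ≤ 1 := by
  by_cases hw : w ∈ lagrangian φ
  · rw [hφ.weylSq_add_of_mem hw, hφ.weylSq_eq_zero hu, add_zero]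
    exact ((mem_lagrangian_iff φ w).mp hw).le
  · rw [hφ.weylSq_eq_zero hw, zero_add]
    rcases hφ.weylSq_eq (w + u) with h | h <;> rw [h]
    exact zero_le_one

theorem add_notMem {u v : Phase n} (hu : u ∉ lagrangian φ) (hv : v ∈ lagrangian φ) :
    u + v ∉ lagrangian φ := fun h => hu (by
  have := hφ.add_mem h hv
  rwa [phase_add_add_self] at this)

/-- A lower bound for the mass of the half-cosets that anticommute with `u`. -/
theorem le_cosetMass_add (g : Fn n) {u : Phase n} (hu : u ∉ lagrangian φ) :
    2 ^ n * ‖ip g φ ^ 2 - ip g (weyl u φ) ^ 2‖ ^ 2 / 4 ≤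
      cosetMass φ g u 0 (-1) + cosetMass φ g u u (-1) := by
  set m : Phase n → ℝ := fun v => (1 - realSign v u) / 2 * (weylSq φ v + weylSq φ (v + u)) with hm
  have hm0 : ∀ v, 0 ≤ m v := fun v => by
    refine mul_nonneg ?_ (add_nonneg (weylSq_nonneg _ _) (weylSq_nonneg _ _))
    rcases realSign_eq_one_or v u with h | h <;> rw [h] <;> norm_num
  have hmoyal := moyal g g (φ + weyl u φ) (φ - weyl u φ)
  have e1 : ip g (φ + weyl u φ) * conj (ip g (φ - weyl u φ)) =
      (ip g φ + ip g (weyl u φ)) * conj (ip g φ - ip g (weyl u φ)) := by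
    rw [ip_add_right, ip_sub_right]
  have hnorm : ∀ v, ‖ip (weyl v (φ + weyl u φ)) (φ - weyl u φ)‖ ≤ 2 * m v := by
    intro v
    have e2 : ip (weyl v φ) (weyl u φ) = comSign v u * ip (weyl v (weyl u φ)) φ := by
      rw [← ip_weyl_left, weyl_comm u v, ip_smul_left, comSign_comm]
    have e3 : ip (weyl v (weyl u φ)) (weyl u φ) = comSign v u * ip (weyl v φ) φ := by
      rw [weyl_comm, ip_smul_left, ip_weyl_weyl]
    have e4 : ip (weyl v (φ + weyl u φ)) (φ - weyl u φ) =
        ((1 - realSign v u : ℝ) : ℂ) * (ip (weyl v φ) φ + ip (weyl v (weyl u φ)) φ) := by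
      rw [weyl_add, ip_sub_right, ip_add_left, ip_add_left, e2, e3, comSign_eq_ofReal]
      push_cast
      ring
    have hs : 0 ≤ 1 - realSign v u := by
      rcases realSign_eq_one_or v u with h | h <;> rw [h] <;> norm_num
    have hle : ∀ (w : Phase n) (z : ℂ), weylSq φ w = ‖z‖ ^ 2 → ‖z‖ ≤ weylSq φ w := by
      intro w z h
      rcases hφ.weylSq_eq w with h1 | h1
      · have h0 : z = 0 := by simpa [h1] using h.symm
        simp [h0, h1]
      · rw [h1] at h ⊢
        exact ((pow_eq_one_iff_of_nonneg (norm_nonneg _) two_ne_zero).mp h.symm).le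
    rw [e4, norm_mul, Complex.norm_real, Real.norm_of_nonneg hs]
    calc (1 - realSign v u) * ‖ip (weyl v φ) φ + ip (weyl v (weyl u φ)) φ‖
        ≤ (1 - realSign v u) * (weylSq φ v + weylSq φ (v + u)) := by
          gcongr
          refine (norm_add_le _ _).trans (add_le_add (hle v _ rfl) (hle _ _ ?_))
          exact weylSq_add φ v u
      _ = 2 * m v := by rw [hm]; ring
  have hsum_m : ∑ v, m v = 2 ^ n := by
    have e2 : ∑ v, m v = ∑ v, (weylSq φ v - weylSq φ v * realSign v u) := by
      have : ∀ v, m v = (1 - realSign v u) / 2 * weylSq φ v +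
          (1 - realSign (v + u) u) / 2 * weylSq φ (v + u) := by
        intro v
        rw [realSign_add_left, realSign_self, hm]
        ring
      rw [Finset.sum_congr rfl fun v _ => this v, Finset.sum_add_distrib,
        sum_phase_translate u (fun v => (1 - realSign v u) / 2 * weylSq φ v),
        ← Finset.sum_add_distrib]
      exact Finset.sum_congr rfl fun v _ => by ring
    rw [e2, Finset.sum_sub_distrib, hφ.sum_weylSq_eq, sum_weylSq_mul_realSign,
      hφ.weylSq_eq_zero hu]
    ring
  have hmass : ∑ v, m v * weylSq g v = cosetMass φ g u 0 (-1) + cosetMass φ g u u (-1) := by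
    have : ∀ v, m v * weylSq g v = (1 - realSign v u) / 2 * weylSq φ v * weylSq g v +
        (1 - realSign (v + u) u) / 2 * weylSq φ (v + u) * weylSq g (v + u + u) := by
      intro v
      rw [realSign_add_left, realSign_self, hm, phase_add_add_self]
      ring
    rw [Finset.sum_congr rfl fun v _ => this v, Finset.sum_add_distrib, sum_phase_translate u
      (fun v => (1 - realSign v u) / 2 * weylSq φ v * weylSq g (v + u)), cosetMass, cosetMass]
    congr 1 <;> refine Finset.sum_congr rfl fun v _ => ?_
    · rw [add_zero]; ring
    · ring
  have hbound : 2 ^ n * ‖ip g φ ^ 2 - ip g (weyl u φ) ^ 2‖ ≤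
      2 * ∑ v, m v * ‖ip (weyl v g) g‖ := by
    have e2 : 2 ^ n * ‖ip g φ ^ 2 - ip g (weyl u φ) ^ 2‖ =
        ‖∑ v, ip (weyl v g) g * conj (ip (weyl v (φ + weyl u φ)) (φ - weyl u φ))‖ := by
      rw [hmoyal, e1, norm_mul, norm_mul, RCLike.norm_conj, ← norm_mul, norm_pow,
        Complex.norm_ofNat, sq_sub_sq]
    rw [e2, Finset.mul_sum]
    refine (norm_sum_le _ _).trans (Finset.sum_le_sum fun v _ => ?_)
    rw [norm_mul, RCLike.norm_conj]
    nlinarith [hnorm v, norm_nonneg (ip (weyl v g) g)]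
  have hcs : (∑ v, m v * ‖ip (weyl v g) g‖) ^ 2 ≤ (∑ v, m v) * ∑ v, m v * weylSq g v := by
    refine Finset.sum_sq_le_sum_mul_sum_of_sq_le_mul _ (fun v _ => hm0 v)
      (fun v _ => mul_nonneg (hm0 v) (weylSq_nonneg _ _)) (fun v _ => le_of_eq ?_)
    rw [weylSq]
    ring
  rw [hsum_m, hmass] at hcs
  have h2 : (0 : ℝ) < 2 ^ n := by positivity
  set D := ‖ip g φ ^ 2 - ip g (weyl u φ) ^ 2‖
  have hD : 0 ≤ D := norm_nonneg _
  have h3 : (2 ^ n * D) ^ 2 ≤ 4 * (2 ^ n *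
      (cosetMass φ g u 0 (-1) + cosetMass φ g u u (-1))) := by
    have : (2 ^ n * D) ^ 2 ≤ (2 * ∑ v, m v * ‖ip (weyl v g) g‖) ^ 2 := by gcongr
    linarith
  have h4 : 2 ^ n * (2 ^ n * D ^ 2 / 4) ≤ 2 ^ n *
      (cosetMass φ g u 0 (-1) + cosetMass φ g u u (-1)) := by nlinarith
  exact le_of_mul_le_mul_left h4 h2

theorem ip_weyl_add_sq (g : Fn n) {u v : Phase n} (hv : v ∈ lagrangian φ)
    (h : realSign v u = -1) : ip g (weyl (u + v) φ) ^ 2 = -ip g (weyl u φ) ^ 2 := by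
  obtain ⟨c, hc, hw⟩ := exists_weyl_weyl (n := n) u v
  obtain ⟨σ, hσ⟩ := hφ.exists_sign hv
  have hs : comSign v u = -1 := by rw [comSign_eq_ofReal, h]; simp
  have h1 : weyl u (weyl v (weyl u (weyl v φ))) = (c * c) • φ := by
    rw [hw φ, weyl_smul, weyl_smul, hw, smul_smul, weyl_weyl_self]
  rw [weyl_comm v u, weyl_smul, weyl_weyl_self, weyl_weyl_self, hs] at h1
  have hcc : c * c = -1 := by
    have h2 : (c * c - -1) • φ = 0 := by rw [sub_smul, h1, sub_self]
    exact sub_eq_zero.mp ((smul_eq_zero.mp h2).resolve_right hφ.ne_zero)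
  have h3 := congrArg (ip g) (hw φ)
  rw [hσ, weyl_smul, ip_smul_right, ip_smul_right] at h3
  have hσ2 : conj ((σ : ℤ) : ℂ) * conj ((σ : ℤ) : ℂ) = 1 := by
    rcases Int.units_eq_one_or σ with rfl | rfl <;> simp
  have hcc' : conj c * conj c = -1 := by rw [← map_mul, hcc]; simp
  linear_combination ip g (weyl (u + v) φ) ^ 2 * hcc' - ip g (weyl u φ) ^ 2 * hσ2 +
    (conj ((σ : ℤ) : ℂ) * ip g (weyl u φ) + conj c * ip g (weyl (u + v) φ)) * h3

theorem cosetMass_shift (g : Fn n) {u v : Phase n} (hv : v ∈ lagrangian φ)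
    (h : realSign v u = -1) :
    cosetMass φ g (u + v) 0 (-1) = cosetMass φ g u 0 (-1) ∧
      cosetMass φ g (u + v) (u + v) (-1) = cosetMass φ g u u 1 := by
  have hsame : ∀ w, weylSq φ w * realSign w (u + v) = weylSq φ w * realSign w u := by
    intro w
    by_cases hw : w ∈ lagrangian φ
    · rw [realSign_add_right, hφ.isotropic hw hv, mul_one]
    · rw [hφ.weylSq_eq_zero hw, zero_mul, zero_mul]
  constructor
  · refine Finset.sum_congr rfl fun w _ => ?_
    linear_combination (-1 / 2 * weylSq g (w + 0)) * hsame w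
  · rw [cosetMass, cosetMass, ← sum_phase_translate v]
    refine Finset.sum_congr rfl fun w _ => ?_
    have e1 : weylSq φ (w + v) = weylSq φ w := by rw [add_comm, hφ.weylSq_add_of_mem hv]
    have e2 : w + v + (u + v) = w + u := by
      rw [add_comm u v, ← add_assoc, phase_add_add_self]
    rw [e1, e2, realSign_add_left, realSign_add_right v u v, realSign_self, h]
    linear_combination (1 / 2 * weylSq g (w + u)) * hsame w

theorem convDist_mass_ge (g : Fn n) {u : Phase n} (hu : u ∉ lagrangian φ) :
    2 * (cosetMass φ g u 0 1 * cosetMass φ g u 0 (-1) +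
      cosetMass φ g u u 1 * cosetMass φ g u u (-1)) / (2 ^ n * l2Norm g ^ 4) ^ 2 ≤
      ∑ v, weylSq φ v * ((1 - realSign v u) / 2) * convDist g v := by
  have e : ∀ v, weylSq φ v * ((1 - realSign v u) / 2) * convDist g v =
      (∑ w, weylSq φ v * ((1 - realSign v u) / 2) * (weylSq g w * weylSq g (v + w))) /
        (2 ^ n * l2Norm g ^ 4) ^ 2 := by
    intro v
    rw [convDist, Finset.mul_sum, Finset.sum_div]
    refine Finset.sum_congr rfl fun w _ => ?_
    rw [charDist_eq, charDist_eq, phase_sub]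
    ring
  rw [Finset.sum_congr rfl fun v _ => e v, ← Finset.sum_div]
  refine div_le_div_of_nonneg_right ?_ (by positivity)
  set m : Phase n → ℝ := fun v => weylSq φ v * ((1 - realSign v u) / 2) with hm
  have hm0 : ∀ v, 0 ≤ m v := fun v => by
    refine mul_nonneg (weylSq_nonneg _ _) ?_
    rcases realSign_eq_one_or v u with h | h <;> rw [h] <;> norm_num
  have h1 : ∑ v, ∑ w, m v * (weylSq φ w + weylSq φ (w + u)) * (weylSq g w * weylSq g (v + w)) ≤
      ∑ v, ∑ w, m v * (weylSq g w * weylSq g (v + w)) := by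
    refine Finset.sum_le_sum fun v _ => Finset.sum_le_sum fun w _ => ?_
    refine mul_le_mul_of_nonneg_right ?_ (mul_nonneg (weylSq_nonneg _ _) (weylSq_nonneg _ _))
    exact mul_le_of_le_one_right (hm0 v) (hφ.weylSq_add_weylSq_add_le_one hu w)
  refine le_trans (le_of_eq ?_) h1
  have h2 : ∑ v, ∑ w, m v * (weylSq φ w + weylSq φ (w + u)) * (weylSq g w * weylSq g (v + w)) =
      ∑ w, ∑ v, m (v + w) * weylSq φ w *
        (weylSq g w * weylSq g v + weylSq g (w + u) * weylSq g (v + u)) := by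
    have e1 : ∀ v, ∑ w, m v * (weylSq φ w + weylSq φ (w + u)) *
        (weylSq g w * weylSq g (v + w)) = ∑ w, m v * weylSq φ w *
          (weylSq g w * weylSq g (v + w) + weylSq g (w + u) * weylSq g (v + w + u)) := by
      intro v
      have e2 : ∀ w, m v * (weylSq φ w + weylSq φ (w + u)) * (weylSq g w * weylSq g (v + w)) =
          m v * weylSq φ w * (weylSq g w * weylSq g (v + w)) +
          m v * weylSq φ (w + u) * (weylSq g (w + u + u) * weylSq g (v + (w + u) + u)) := by
        intro w
        rw [← add_assoc v w u, phase_add_add_self, phase_add_add_self]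
        ring
      rw [Finset.sum_congr rfl fun w _ => e2 w, Finset.sum_add_distrib, sum_phase_translate u
        (fun w => m v * weylSq φ w * (weylSq g (w + u) * weylSq g (v + w + u))),
        ← Finset.sum_add_distrib]
      exact Finset.sum_congr rfl fun w _ => by ring
    rw [Finset.sum_congr rfl fun v _ => e1 v, Finset.sum_comm]
    refine Finset.sum_congr rfl fun w _ => ?_
    rw [← sum_phase_translate w]
    refine Finset.sum_congr rfl fun v _ => ?_
    rw [phase_add_add_self]
  rw [h2]
  have e3 : ∀ v w, m (v + w) * weylSq φ w = weylSq φ v * weylSq φ w *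
      ((1 + realSign v u) / 2 * ((1 - realSign w u) / 2) +
        (1 - realSign v u) / 2 * ((1 + realSign w u) / 2)) := by
    intro v w
    have e4 : weylSq φ (v + w) * weylSq φ w = weylSq φ v * weylSq φ w := by
      by_cases hw : w ∈ lagrangian φ
      · rw [add_comm, hφ.weylSq_add_of_mem hw]
      · rw [hφ.weylSq_eq_zero hw, mul_zero, mul_zero]
    simp only [hm]
    rw [realSign_add_left]
    linear_combination ((1 - realSign v u * realSign w u) / 2) * e4
  have e5 : 2 * (cosetMass φ g u 0 1 * cosetMass φ g u 0 (-1) +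
      cosetMass φ g u u 1 * cosetMass φ g u u (-1)) =
      cosetMass φ g u 0 1 * cosetMass φ g u 0 (-1) + cosetMass φ g u 0 (-1) * cosetMass φ g u 0 1 +
      (cosetMass φ g u u 1 * cosetMass φ g u u (-1) +
        cosetMass φ g u u (-1) * cosetMass φ g u u 1) := by ring
  rw [e5]
  simp only [cosetMass, Finset.sum_mul_sum, ← Finset.sum_add_distrib]
  refine Finset.sum_congr rfl fun w _ => Finset.sum_congr rfl fun v _ => ?_
  rw [e3, add_zero, add_zero]
  ring

end IsStabilizerState

/-! ### Local maximizers -/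

theorem norm_sq_sub_sq_ge {γ : ℝ} (h1 : 1 / 2 < γ) (h2 : γ ≤ 1) {z y : ℂ}
    (hp : γ * ‖z + y‖ ^ 2 ≤ 2 * ‖z‖ ^ 2) (hm : γ * ‖z - y‖ ^ 2 ≤ 2 * ‖z‖ ^ 2) :
    3 / 2 * (γ - 1 / 2) * ‖z‖ ^ 2 ≤ ‖z ^ 2 - y ^ 2‖ := by
  have hpar : ‖z + y‖ ^ 2 + ‖z - y‖ ^ 2 = 2 * (‖z‖ ^ 2 + ‖y‖ ^ 2) := by
    have := parallelogram_law_with_norm ℝ z y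
    nlinarith
  have hprod : ‖z ^ 2 - y ^ 2‖ ^ 2 = ‖z + y‖ ^ 2 * ‖z - y‖ ^ 2 := by
    rw [sq_sub_sq, norm_mul, mul_pow]
  have htri : ‖z‖ ^ 2 - ‖y‖ ^ 2 ≤ ‖z ^ 2 - y ^ 2‖ := by
    have := norm_sub_norm_le (z ^ 2) (y ^ 2)
    rwa [norm_pow, norm_pow] at this
  set A := ‖z + y‖ ^ 2
  set B := ‖z - y‖ ^ 2
  set α := ‖z‖ ^ 2
  set β := ‖y‖ ^ 2
  have hα : 0 ≤ α := sq_nonneg _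
  set δ := γ - 1 / 2 with hδ
  have hγ : γ = δ + 1 / 2 := by rw [hδ]; ring
  by_contra hcon
  push Not at hcon
  have hβ : α - β < 3 / 2 * δ * α := lt_of_le_of_lt htri hcon
  have hα0 : 0 < α := by
    rcases hα.lt_or_eq with h | h
    · exact h
    · rw [← h] at hcon
      have := norm_nonneg (z ^ 2 - y ^ 2)
      linarith
  have hsum : 2 * α * (2 - 3 / 2 * δ) ≤ A + B := by nlinarith
  have hup : ∀ X : ℝ, γ * X ≤ 2 * α → X ≤ α * (4 - 4 * δ) := by
    intro X hX
    have h3 : (δ + 1 / 2) * (4 - 4 * δ) ≥ 2 := by nlinarith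
    have h4 : γ * X ≤ γ * (α * (4 - 4 * δ)) := by
      rw [hγ] at hX ⊢
      nlinarith
    exact le_of_mul_le_mul_left h4 (by linarith)
  have hA := hup A hp
  have hB := hup B hm
  have hA' : δ * α ≤ A := by nlinarith
  have hB' : δ * α ≤ B := by nlinarith
  have hd : 0 < δ := by linarith
  have hd' : δ ≤ 1 / 2 := by linarith
  have hAB : 5 / 4 * α * (δ * α) ≤ A * B := by
    have h5 : 5 / 2 * α ≤ A + B := by nlinarith
    have hda : 0 ≤ δ * α := by positivity
    rcases le_total (5 / 4 * α) A with h | h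
    · exact mul_le_mul h hB' hda (by linarith)
    · have h' : 5 / 4 * α ≤ B := by linarith
      have := mul_le_mul h' hA' hda (by linarith)
      linarith
  have hlt : ‖z ^ 2 - y ^ 2‖ ^ 2 < (3 / 2 * δ * α) ^ 2 := by
    have := norm_nonneg (z ^ 2 - y ^ 2)
    gcongr
  rw [hprod] at hlt
  have : 0 < δ * α ^ 2 := by positivity
  nlinarith

/-- The properties of `f` with respect to `φ` that are preserved by good projections. -/
structure LocallyMaximal (γ τ : ℝ) (φ g : Fn n) : Prop where
  oneBounded : OneBounded g
  le_ip : τ ≤ ‖ip g φ‖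
  local_max : ∀ u ∉ lagrangian φ, ∀ c : ℂ, c = 1 ∨ c = -1 →
    γ * ‖ip g φ + c * ip g (weyl u φ)‖ ^ 2 ≤ 2 * ‖ip g φ‖ ^ 2

theorem IsApproxLocalMaximizer.locallyMaximal {γ τ : ℝ} {f φ : Fn n}
    (h : IsApproxLocalMaximizer γ f φ) (hf : OneBounded f) (hτ : τ ≤ ‖ip f φ‖) :
    LocallyMaximal γ τ φ f := by
  refine ⟨hf, hτ, fun u hu c hc => ?_⟩
  obtain ⟨h1, h2⟩ := h.1.neighbour hu hc
  have h3 := h.2 _ h1 h2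
  have h4 : ‖conj ((Real.sqrt 2 : ℂ))⁻¹‖ ^ 2 = 1 / 2 := by
    rw [RCLike.norm_conj, norm_inv, Complex.norm_real, Real.norm_eq_abs, inv_pow, sq_abs,
      Real.sq_sqrt (by norm_num)]
    norm_num
  have hcc : conj c = c := by rcases hc with rfl | rfl <;> simp
  rw [ip_smul_right, ip_add_right, ip_smul_right, norm_mul, mul_pow, h4, hcc] at h3
  linarith

theorem OneBounded.l2Norm_le_one {g : Fn n} (hg : OneBounded g) : l2Norm g ≤ 1 := by
  rw [← sq_le_one_iff₀ (l2Norm_nonneg g), l2Norm_sq, expect_eq_real, div_le_one (by positivity)]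
  calc ∑ x, ‖g x‖ ^ 2 ≤ ∑ _x : Vec n, (1 : ℝ) :=
        Finset.sum_le_sum fun x _ => pow_le_one₀ (norm_nonneg _) (hg x)
    _ = 2 ^ n := by simp

namespace LocallyMaximal

variable {γ τ : ℝ} {φ g : Fn n}

theorem le_l2Norm (hφ : IsStabilizerState φ) (h : LocallyMaximal γ τ φ g) : τ ≤ l2Norm g := by
  have := norm_ip_le g φ
  rw [hφ.1, mul_one] at this
  exact h.le_ip.trans this

theorem mass_anticommuting_ge (hφ : IsStabilizerState φ) (h : LocallyMaximal γ τ φ g)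
    (hγ : 1 / 2 < γ) (hγ1 : γ ≤ 1) (hτ : 0 < τ) {u : Phase n} (hu : u ∉ lagrangian φ) :
    9 / 4 * ((γ - 1 / 2) ^ 2 * τ ^ 8 / 8) ≤
      ∑ v, weylSq φ v * ((1 - realSign v u) / 2) * convDist g v := by
  obtain ⟨l, hl, hlu⟩ := hφ.exists_anticommuting hu
  have hu' := hφ.add_notMem hu hl
  have hN : 0 < l2Norm g := hτ.trans_le (h.le_l2Norm hφ)
  have hN1 : l2Norm g ≤ 1 := h.oneBounded.l2Norm_le_one
  refine le_trans ?_ (hφ.convDist_mass_ge g hu)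
  have hrel := cosetMass_relation φ g u
  have hb1 := hφ.le_cosetMass_add g hu
  have hb2 := hφ.le_cosetMass_add g hu'
  obtain ⟨hs1, hs2⟩ := hφ.cosetMass_shift g hl hlu
  rw [hs1, hs2] at hb2
  have hy := hφ.ip_weyl_add_sq g hl hlu
  have hp := h.local_max u hu 1 (Or.inl rfl)
  have hm := h.local_max u hu (-1) (Or.inr rfl)
  have hp' := h.local_max _ hu' 1 (Or.inl rfl)
  have hm' := h.local_max _ hu' (-1) (Or.inr rfl)
  rw [one_mul] at hp hp'
  rw [neg_one_mul, ← sub_eq_add_neg] at hm hm'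
  have hc1 := norm_sq_sub_sq_ge hγ hγ1 hp hm
  have hc2 := norm_sq_sub_sq_ge hγ hγ1 hp' hm'
  have htau := h.le_ip
  rw [hy, sub_neg_eq_add] at hb2 hc2
  have htri : 2 * ‖ip g φ‖ ^ 2 ≤ ‖ip g φ ^ 2 - ip g (weyl u φ) ^ 2‖ +
      ‖ip g φ ^ 2 + ip g (weyl u φ) ^ 2‖ := by
    have := norm_add_le (ip g φ ^ 2 - ip g (weyl u φ) ^ 2) (ip g φ ^ 2 + ip g (weyl u φ) ^ 2)
    rw [sub_add_add_cancel, ← two_mul, norm_mul, norm_pow, Complex.norm_ofNat] at this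
    exact this
  set X := ‖ip g φ ^ 2 - ip g (weyl u φ) ^ 2‖
  set Y := ‖ip g φ ^ 2 + ip g (weyl u φ) ^ 2‖
  set pI := cosetMass φ g u 0 1
  set pZ := cosetMass φ g u 0 (-1)
  set pX := cosetMass φ g u u 1
  set pY := cosetMass φ g u u (-1)
  have hα : τ ^ 2 ≤ ‖ip g φ‖ ^ 2 := by gcongr
  set α := ‖ip g φ‖ ^ 2
  have hα0 : 0 ≤ α := sq_nonneg _
  have hd : 0 < γ - 1 / 2 := by linarith
  set δ := γ - 1 / 2
  have hX0 : 0 ≤ X := norm_nonneg _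
  have hY0 : 0 ≤ Y := norm_nonneg _
  have hXY : 3 / 2 * δ * α ^ 2 ≤ X * Y := by
    have hda : 0 ≤ 3 / 2 * δ * α := by positivity
    rcases le_total α X with h1 | h1
    · have := mul_le_mul h1 hc2 hda hX0
      linarith
    · have h1' : α ≤ Y := by linarith
      have := mul_le_mul hc1 h1' hα0 hX0
      linarith
  have hXY2 : 3 / 2 * δ * τ ^ 4 ≤ X * Y := by
    refine le_trans ?_ hXY
    have : τ ^ 4 ≤ α ^ 2 := by
      calc τ ^ 4 = (τ ^ 2) ^ 2 := by ring
        _ ≤ α ^ 2 := by gcongr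
    gcongr
  rw [le_div_iff₀ (by positivity)]
  have hq : (2 ^ n * X ^ 2 / 4) * (2 ^ n * Y ^ 2 / 4) ≤ (pZ + pY) * (pZ + pX) :=
    mul_le_mul hb1 hb2 (by positivity) ((by positivity : (0 : ℝ) ≤ 2 ^ n * X ^ 2 / 4).trans hb1)
  have hq2 : 2 * (pI * pZ + pX * pY) = 2 * ((pZ + pY) * (pZ + pX)) := by rw [hrel]; ring
  rw [hq2]
  have hN8 : (2 ^ n * l2Norm g ^ 4) ^ 2 ≤ (2 ^ n) ^ 2 := by
    have : l2Norm g ^ 4 ≤ 1 := pow_le_one₀ hN.le hN1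
    have h2 : (2 : ℝ) ^ n * l2Norm g ^ 4 ≤ 2 ^ n := mul_le_of_le_one_right (by positivity) this
    gcongr
  have hfin : (3 / 2 * δ * τ ^ 4) ^ 2 ≤ (X * Y) ^ 2 := by gcongr
  calc 9 / 4 * (δ ^ 2 * τ ^ 8 / 8) * (2 ^ n * l2Norm g ^ 4) ^ 2
      ≤ 9 / 4 * (δ ^ 2 * τ ^ 8 / 8) * (2 ^ n) ^ 2 := by gcongr
    _ = 2 * ((2 ^ n) ^ 2 * (3 / 2 * δ * τ ^ 4) ^ 2 / 16) := by ring
    _ ≤ 2 * ((2 ^ n) ^ 2 * (X * Y) ^ 2 / 16) := by gcongr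
    _ = 2 * ((2 ^ n * X ^ 2 / 4) * (2 ^ n * Y ^ 2 / 4)) := by ring
    _ ≤ _ := by gcongr

end LocallyMaximal

/-! ### Projections -/

theorem proj_eq (v : Phase n) (σ : ℤˣ) (g : Fn n) :
    proj v σ g = (1 / 2 : ℂ) • (g + ((σ : ℤ) : ℂ) • weyl v g) := by
  funext x
  simp only [proj, weyl, Pi.smul_apply, Pi.add_apply, smul_eq_mul]
  ring

theorem conj_unit (σ : ℤˣ) : conj ((σ : ℤ) : ℂ) = ((σ : ℤ) : ℂ) := by
  rcases Int.units_eq_one_or σ with rfl | rfl <;> simp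

theorem unit_mul_self (σ : ℤˣ) : ((σ : ℤ) : ℂ) * ((σ : ℤ) : ℂ) = 1 := by
  rcases Int.units_eq_one_or σ with rfl | rfl <;> simp

theorem norm_unit (σ : ℤˣ) : ‖((σ : ℤ) : ℂ)‖ = 1 := by
  rcases Int.units_eq_one_or σ with rfl | rfl <;> simp

theorem OneBounded.proj {g : Fn n} (hg : OneBounded g) (v : Phase n) (σ : ℤˣ) :
    OneBounded (proj v σ g) := by
  intro x
  rw [StabSampling.proj, norm_div, Complex.norm_ofNat, div_le_one (by norm_num)]
  refine (norm_add_le _ _).trans ?_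
  simp only [norm_mul, norm_unit, norm_pow, Complex.norm_I, one_pow, norm_chi, one_mul]
  linarith [hg x, hg (x + v.1)]

theorem ip_proj (v : Phase n) (σ : ℤˣ) (g h : Fn n) :
    ip (proj v σ g) h = (ip g h + ((σ : ℤ) : ℂ) * ip g (weyl v h)) / 2 := by
  rw [proj_eq, ip_smul_left, ip_add_left, ip_smul_left, ip_weyl_left]
  ring

theorem l2Norm_proj_sq_le (v : Phase n) (σ : ℤˣ) (g : Fn n) :
    l2Norm (proj v σ g) ^ 2 ≤ (l2Norm g ^ 2 + ‖ip (weyl v g) g‖) / 2 := by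
  have h : ip (proj v σ g) (proj v σ g) =
      (((l2Norm g ^ 2 : ℝ) : ℂ) + ((σ : ℤ) : ℂ) * ip (weyl v g) g) / 2 := by
    have e : ip g (weyl v g) = ip (weyl v g) g := (ip_weyl_left v g g).symm
    have h2 : conj (1 / 2 : ℂ) = 1 / 2 := by simp [Complex.conj_ofNat]
    rw [proj_eq]
    simp only [ip_smul_left, ip_smul_right, ip_add_left, ip_add_right, ip_weyl_weyl, conj_unit, e,
      ip_self g, h2]
    linear_combination (1 / 4 * ((l2Norm g ^ 2 : ℝ) : ℂ)) * unit_mul_self σ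
  rw [ip_self] at h
  have h3 := congrArg norm h
  rw [Complex.norm_real, Real.norm_of_nonneg (sq_nonneg _), norm_div, Complex.norm_ofNat] at h3
  rw [h3]
  refine div_le_div_of_nonneg_right ((norm_add_le _ _).trans ?_) (by norm_num)
  rw [Complex.norm_real, Real.norm_of_nonneg (sq_nonneg _), norm_mul, norm_unit, one_mul]

theorem LocallyMaximal.proj {γ τ : ℝ} {φ g : Fn n} (h : LocallyMaximal γ τ φ g)
    (hγ1 : γ ≤ 1) {v : Phase n} {σ : ℤˣ}
    (hσ : weyl v φ = ((σ : ℤ) : ℂ) • φ) : LocallyMaximal γ τ φ (proj v σ g) := by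
  have e1 : ip (StabSampling.proj v σ g) φ = ip g φ := by
    rw [ip_proj, hσ, ip_smul_right, conj_unit]
    linear_combination (1 / 2 * ip g φ) * unit_mul_self σ
  refine ⟨h.oneBounded.proj v σ, by rw [e1]; exact h.le_ip, fun u hu c hc => ?_⟩
  have e2 : ip (StabSampling.proj v σ g) (weyl u φ) =
      (1 + comSign v u) / 2 * ip g (weyl u φ) := by
    rw [ip_proj, weyl_comm, hσ, weyl_smul, ip_smul_right, ip_smul_right, conj_unit, conj_comSign]
    linear_combination (1 / 2 * comSign v u * ip g (weyl u φ)) * unit_mul_self σ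
  rw [e1, e2]
  rcases comSign_eq_one_or v u with hs | hs
  · rw [hs]
    norm_num only
    rw [one_mul]
    exact h.local_max u hu c hc
  · rw [hs]
    have : ip g φ + c * ((1 + -1) / 2 * ip g (weyl u φ)) = ip g φ := by ring
    rw [this]
    nlinarith [sq_nonneg ‖ip g φ‖]

/-! ### Expectations with respect to probability mass functions -/

/-- Expectation of a nonnegative function. -/
def pmfExp {α : Type} (p : PMF α) (F : α → ENNReal) : ENNReal := ∑' a, p a * F a

open Classical in
/-- Indicator of a proposition. -/
def ind (P : Prop) : ENNReal := if P then 1 else 0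

theorem ind_of_true {P : Prop} (h : P) : ind P = 1 := if_pos h

theorem ind_of_false {P : Prop} (h : ¬P) : ind P = 0 := if_neg h

theorem ind_mono {P Q : Prop} (h : P → Q) : ind P ≤ ind Q := by
  by_cases hP : P
  · rw [ind_of_true hP, ind_of_true (h hP)]
  · rw [ind_of_false hP]; exact zero_le

theorem ind_le_one (P : Prop) : ind P ≤ 1 := by
  by_cases h : P
  · rw [ind_of_true h]
  · rw [ind_of_false h]; exact zero_le

theorem ind_or_le (P Q : Prop) : ind (P ∨ Q) ≤ ind P + ind Q := by
  by_cases hP : P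
  · rw [ind_of_true hP]; exact (ind_le_one _).trans le_self_add
  · exact (ind_mono fun h => h.resolve_left hP).trans le_add_self

theorem ind_add_ind_not (P : Prop) : ind P + ind (¬P) = 1 := by
  by_cases h : P
  · rw [ind_of_true h, ind_of_false (not_not.mpr h), add_zero]
  · rw [ind_of_false h, ind_of_true h, zero_add]

section pmfExp

variable {α β : Type}

theorem pmfExp_pure (a : α) (F : α → ENNReal) : pmfExp (PMF.pure a) F = F a := by
  rw [pmfExp, tsum_eq_single a]
  · simp
  · intro b hb
    simp [hb]

theorem pmfExp_bind (p : PMF α) (q : α → PMF β) (F : β → ENNReal) :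
    pmfExp (p.bind q) F = pmfExp p fun a => pmfExp (q a) F := by
  simp only [pmfExp, PMF.bind_apply, ← ENNReal.tsum_mul_left, ← ENNReal.tsum_mul_right]
  rw [ENNReal.tsum_comm]
  simp only [mul_assoc]

theorem pmfExp_mono (p : PMF α) {F G : α → ENNReal} (h : ∀ a, F a ≤ G a) :
    pmfExp p F ≤ pmfExp p G :=
  ENNReal.tsum_le_tsum fun a => mul_le_mul_right (h a) _

theorem pmfExp_const (p : PMF α) (c : ENNReal) : pmfExp p (fun _ => c) = c := by
  rw [pmfExp, ENNReal.tsum_mul_right, p.tsum_coe, one_mul]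

theorem pmfExp_add (p : PMF α) (F G : α → ENNReal) :
    pmfExp p (fun a => F a + G a) = pmfExp p F + pmfExp p G := by
  simp only [pmfExp, mul_add, ENNReal.tsum_add]

theorem pmfExp_const_mul (p : PMF α) (c : ENNReal) (F : α → ENNReal) :
    pmfExp p (fun a => c * F a) = c * pmfExp p F := by
  simp only [pmfExp, ← ENNReal.tsum_mul_left]
  exact tsum_congr fun a => by ring

theorem pmfExp_sum {ι : Type} (p : PMF α) (s : Finset ι) (F : ι → α → ENNReal) :
    pmfExp p (fun a => ∑ i ∈ s, F i a) = ∑ i ∈ s, pmfExp p (F i) := by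
  classical
  induction s using Finset.induction_on with
  | empty => simp [pmfExp]
  | insert i s hi ih => simp only [Finset.sum_insert hi, pmfExp_add, ih]

theorem toOuterMeasure_eq_pmfExp (p : PMF α) (s : Set α) :
    p.toOuterMeasure s = pmfExp p fun a => ind (a ∈ s) := by
  classical
  rw [PMF.toOuterMeasure_apply, pmfExp]
  refine tsum_congr fun a => ?_
  by_cases h : a ∈ s
  · rw [Set.indicator_of_mem h, ind_of_true h, mul_one]
  · rw [Set.indicator_of_notMem h, ind_of_false h, mul_zero]

theorem pmfExp_fintype [Fintype α] (p : PMF α) (F : α → ENNReal) :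
    pmfExp p F = ∑ a, p a * F a := tsum_fintype _

theorem pmfExp_uniform [Fintype α] [Nonempty α] (F : α → ENNReal) :
    pmfExp (PMF.uniformOfFintype α) F = ∑ a, (Fintype.card α : ENNReal)⁻¹ * F a := by
  simp [pmfExp_fintype]

theorem pmfExp_iidSamples_succ (p : PMF α) (m : ℕ) (F : List α → ENNReal) :
    pmfExp (iidSamples p (m + 1)) F =
      pmfExp p fun x => pmfExp (iidSamples p m) fun xs => F (x :: xs) := by
  have : iidSamples p (m + 1) =
      p.bind fun x => (iidSamples p m).bind fun xs => PMF.pure (x :: xs) := rfl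
  simp only [this, pmfExp_bind, pmfExp_pure]

theorem pmfExp_iidSamples_mono (p : PMF α) (m : ℕ) {F G : List α → ENNReal}
    (h : ∀ l, l.length = m → F l ≤ G l) :
    pmfExp (iidSamples p m) F ≤ pmfExp (iidSamples p m) G := by
  induction m generalizing F G with
  | zero =>
    have : iidSamples p 0 = PMF.pure [] := rfl
    simpa only [this, pmfExp_pure] using h [] rfl
  | succ m ih =>
    rw [pmfExp_iidSamples_succ, pmfExp_iidSamples_succ]
    exact pmfExp_mono _ fun x => ih fun l hl => h _ (by simp [hl])

theorem pmfExp_iidSamples_prod (p : PMF α) (m : ℕ) (h : α → ENNReal) :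
    pmfExp (iidSamples p m) (fun l => (l.map h).prod) = pmfExp p h ^ m := by
  induction m with
  | zero =>
    have : iidSamples p 0 = PMF.pure [] := rfl
    simp [this, pmfExp_pure]
  | succ m ih =>
    rw [pmfExp_iidSamples_succ]
    simp only [List.map_cons, List.prod_cons, pmfExp_const_mul, ih]
    simp only [mul_comm (h _), pmfExp_const_mul]
    rw [pow_succ]

theorem list_prod_ind (l : List α) (P : α → Prop) :
    (l.map fun a => ind (P a)).prod = ind (∀ a ∈ l, P a) := by
  induction l with
  | nil => simp [ind_of_true]
  | cons a l ih =>
    rw [List.map_cons, List.prod_cons, ih]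
    by_cases h : P a
    · rw [ind_of_true h, one_mul]
      simp [h]
    · rw [ind_of_false h, zero_mul, ind_of_false]
      simp [h]

theorem list_prod_exp (l : List α) (X : α → ℝ) :
    (l.map fun a => ENNReal.ofReal (Real.exp (X a))).prod =
      ENNReal.ofReal (Real.exp (l.map X).sum) := by
  induction l with
  | nil => simp
  | cons a l ih =>
    rw [List.map_cons, List.prod_cons, ih, List.map_cons, List.sum_cons, Real.exp_add,
      ENNReal.ofReal_mul (Real.exp_nonneg _)]

end pmfExp

/-! ### A Hoeffding bound for estimates of Fourier coefficients -/

theorem pmfExp_exp_le (X : Vec n → ℝ) (hX : ∀ x, |X x| ≤ 2) (h0 : ∑ x, X x = 0) (t : ℝ) :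
    pmfExp (PMF.uniformOfFintype (Vec n)) (fun x => ENNReal.ofReal (Real.exp (t * X x))) ≤
      ENNReal.ofReal (Real.exp (2 * t ^ 2)) := by
  have hpt : ∀ x, Real.exp (t * X x) ≤ Real.cosh (2 * t) + X x / 2 * Real.sinh (2 * t) := by
    intro x
    have h1 : |X x / 2| ≤ 1 := by rw [abs_div, abs_two]; linarith [hX x]
    have := Real.exp_mul_le_cosh_add_mul_sinh h1 (2 * t)
    have e : X x / 2 * (2 * t) = t * X x := by ring
    rwa [e] at this
  rw [pmfExp_uniform]
  have hc : (Fintype.card (Vec n) : ENNReal)⁻¹ = ENNReal.ofReal ((2 ^ n)⁻¹) := by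
    rw [ENNReal.ofReal_inv_of_pos (by positivity)]
    congr 1
    rw [ENNReal.ofReal_pow (by norm_num)]
    simp
  simp only [hc, ← ENNReal.ofReal_mul (by positivity : (0 : ℝ) ≤ (2 ^ n)⁻¹)]
  rw [← ENNReal.ofReal_sum_of_nonneg (fun _ _ => by positivity)]
  refine ENNReal.ofReal_le_ofReal ?_
  rw [← Finset.mul_sum, inv_mul_le_iff₀ (by positivity)]
  calc ∑ x, Real.exp (t * X x) ≤ ∑ x, (Real.cosh (2 * t) + X x / 2 * Real.sinh (2 * t)) :=
        Finset.sum_le_sum fun x _ => hpt x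
    _ = 2 ^ n * Real.cosh (2 * t) := by
        rw [Finset.sum_add_distrib, ← Finset.sum_mul, ← Finset.sum_div, h0]
        simp
    _ ≤ 2 ^ n * Real.exp (2 * t ^ 2) := by
        have := Real.cosh_le_exp_half_sq (2 * t)
        have e : (2 * t) ^ 2 / 2 = 2 * t ^ 2 := by ring
        rw [e] at this
        gcongr

theorem exists_re_ge (z : ℂ) :
    ∃ w ∈ ({1, -1, Complex.I, -Complex.I} : Finset ℂ), ‖z‖ / 2 ≤ (w * z).re := by
  have h := Complex.norm_le_abs_re_add_abs_im z
  rcases le_total (|z.im|) (|z.re|) with h1 | h1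
  · rcases abs_cases z.re with ⟨h2, _⟩ | ⟨h2, _⟩
    · exact ⟨1, by simp, by rw [one_mul]; linarith⟩
    · exact ⟨-1, by simp, by rw [neg_one_mul, Complex.neg_re]; linarith⟩
  · rcases abs_cases z.im with ⟨h2, _⟩ | ⟨h2, _⟩
    · exact ⟨-Complex.I, by simp, by simp; linarith⟩
    · exact ⟨Complex.I, by simp, by simp; linarith⟩

theorem norm_of_mem_directions {w : ℂ}
    (hw : w ∈ ({1, -1, Complex.I, -Complex.I} : Finset ℂ)) : ‖w‖ = 1 := by
  simp only [Finset.mem_insert, Finset.mem_singleton] at hw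
  rcases hw with rfl | rfl | rfl | rfl <;> simp

theorem card_directions_le : ({1, -1, Complex.I, -Complex.I} : Finset ℂ).card ≤ 4 :=
  Finset.card_le_four

theorem norm_fourier_le {h : Fn n} (hh : OneBounded h) (b : Vec n) : ‖fourier h b‖ ≤ 1 := by
  rw [fourier, expect_eq, norm_div, norm_pow, Complex.norm_ofNat, div_le_one (by positivity)]
  calc ‖∑ x, h x * chi b x‖ ≤ ∑ _x : Vec n, (1 : ℝ) := norm_sum_le_of_le _ fun x _ => by
        rw [norm_mul, norm_chi, mul_one]; exact hh x
    _ = 2 ^ n := by simp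

theorem fourEst_tail (N : ℕ) {h : Fn n} (hh : OneBounded h) (b : Vec n) {η : ℝ} (hη : 0 < η) :
    pmfExp (fourEst N h b) (fun c => ind (η < ‖c - fourier h b‖)) ≤
      ENNReal.ofReal (4 * Real.exp (-(N * η ^ 2 / 32))) := by
  set μ := fourier h b with hμ
  set X : ℂ → Vec n → ℝ := fun w x => (w * (h x * chi b x - μ)).re with hX
  set t := η / 8 with ht
  set D : Finset ℂ := {1, -1, Complex.I, -Complex.I} with hD
  have hX2 : ∀ w ∈ D, ∀ x, |X w x| ≤ 2 := by
    intro w hw x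
    refine (Complex.abs_re_le_norm _).trans ?_
    rw [norm_mul, norm_of_mem_directions hw, one_mul]
    refine (norm_sub_le _ _).trans ?_
    rw [norm_mul, norm_chi, mul_one]
    linarith [hh x, norm_fourier_le hh b]
  have hX0 : ∀ w, ∑ x, X w x = 0 := by
    intro w
    simp only [hX]
    rw [← Complex.re_sum, ← Finset.mul_sum, Finset.sum_sub_distrib]
    have : ∑ x, h x * chi b x = 2 ^ n * μ := by
      rw [hμ, fourier, expect_eq]
      field_simp
    rw [this]
    simp
  have hE : fourEst N h b = (iidSamples (PMF.uniformOfFintype (Vec n)) N).bind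
    fun xs => PMF.pure ((xs.map fun x => h x * chi b x).sum / N) := rfl
  rw [hE, pmfExp_bind]
  simp only [pmfExp_pure]
  have hpt : ∀ xs : List (Vec n), xs.length = N →
      ind (η < ‖(xs.map fun x => h x * chi b x).sum / N - μ‖) ≤
        ∑ w ∈ D, ENNReal.ofReal (Real.exp (-(t * N * η / 2))) *
          (xs.map fun x => ENNReal.ofReal (Real.exp (t * X w x))).prod := by
    intro xs hxs
    have hsum : ∀ w, (xs.map fun x => t * X w x).sum =
        t * (w * ((xs.map fun x => h x * chi b x).sum - N * μ)).re := by
      intro w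
      rw [← hxs]
      clear hxs
      induction xs with
      | nil => simp
      | cons x xs ih =>
        rw [List.map_cons, List.sum_cons, ih, List.map_cons, List.sum_cons, List.length_cons, hX]
        rw [← mul_add, ← Complex.add_re]
        congr 2
        push_cast
        ring
    by_cases hev : η < ‖(xs.map fun x => h x * chi b x).sum / N - μ‖
    · rw [ind_of_true hev]
      set z := (xs.map fun x => h x * chi b x).sum / N - μ with hz
      have hNz : (xs.map fun x => h x * chi b x).sum - N * μ = N * z := by
        rcases Nat.eq_zero_or_pos N with h0 | h0
        · have : xs = [] := List.length_eq_zero_iff.mp (hxs.trans h0)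
          simp [this, h0]
        · have : (N : ℂ) ≠ 0 := by exact_mod_cast h0.ne'
          rw [hz]
          field_simp
      obtain ⟨w, hw, hwz⟩ := exists_re_ge z
      refine le_trans ?_ (Finset.single_le_sum
        (f := fun w => ENNReal.ofReal (Real.exp (-(t * N * η / 2))) *
          (xs.map fun x => ENNReal.ofReal (Real.exp (t * X w x))).prod)
        (fun _ _ => zero_le) hw)
      rw [list_prod_exp, ← ENNReal.ofReal_mul (Real.exp_nonneg _), ← Real.exp_add, hsum, hNz,
        ← ENNReal.ofReal_one]
      refine ENNReal.ofReal_le_ofReal (Real.one_le_exp ?_)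
      have e : (w * ((N : ℂ) * z)).re = N * (w * z).re := by
        rw [mul_left_comm, ← Complex.ofReal_natCast, Complex.re_ofReal_mul]
      rw [e]
      have h2 : η / 2 ≤ (w * z).re := by linarith
      have h3 : 0 ≤ t * N := by positivity
      nlinarith
    · rw [ind_of_false hev]; exact zero_le
  refine (pmfExp_iidSamples_mono _ N hpt).trans ?_
  rw [pmfExp_sum]
  simp only [pmfExp_const_mul, pmfExp_iidSamples_prod]
  have hterm : ∀ w ∈ D, ENNReal.ofReal (Real.exp (-(t * N * η / 2))) *
      pmfExp (PMF.uniformOfFintype (Vec n)) (fun x => ENNReal.ofReal (Real.exp (t * X w x))) ^ N ≤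
      ENNReal.ofReal (Real.exp (-(N * η ^ 2 / 32))) := by
    intro w hw
    calc _ ≤ ENNReal.ofReal (Real.exp (-(t * N * η / 2))) *
          ENNReal.ofReal (Real.exp (2 * t ^ 2)) ^ N := by
          gcongr
          exact pmfExp_exp_le _ (hX2 w hw) (hX0 w) t
      _ = _ := by
          rw [← ENNReal.ofReal_pow (Real.exp_nonneg _), ← ENNReal.ofReal_mul (Real.exp_nonneg _),
            ← Real.exp_nat_mul, ← Real.exp_add]
          congr 2
          rw [ht]
          ring
  calc _ ≤ ∑ _w ∈ D, ENNReal.ofReal (Real.exp (-(N * η ^ 2 / 32))) := Finset.sum_le_sum hterm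
    _ = (D.card : ENNReal) * ENNReal.ofReal (Real.exp (-(N * η ^ 2 / 32))) := by simp
    _ ≤ 4 * ENNReal.ofReal (Real.exp (-(N * η ^ 2 / 32))) := by
        gcongr
        have : D.card ≤ 4 := card_directions_le
        exact_mod_cast this
    _ = _ := by
        rw [ENNReal.ofReal_mul (by norm_num)]
        simp

/-! ### Extraction of bases -/

theorem listSpan_cons (v : Phase n) (l : List (Phase n)) :
    listSpan (v :: l) = Submodule.span (ZMod 2) {v} ⊔ listSpan l := by
  rw [listSpan, listSpan, ← Submodule.span_union]
  congr 1
  ext w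
  simp

theorem listSpan_extractBasis (l : List (Phase n)) : listSpan (extractBasis l) = listSpan l := by
  induction l with
  | nil => rfl
  | cons v l ih =>
    rw [extractBasis]
    split_ifs with h
    · rw [listSpan_cons, ← ih, right_eq_sup, Submodule.span_singleton_le_iff_mem]
      exact h
    · rw [listSpan_cons, listSpan_cons, ih]

theorem linearIndependent_extractBasis (l : List (Phase n)) :
    LinearIndependent (ZMod 2) (extractBasis l).get := by
  induction l with
  | nil =>
    have : IsEmpty (Fin (extractBasis ([] : List (Phase n))).length) := Fin.isEmpty
    exact linearIndependent_empty_type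
  | cons v l ih =>
    by_cases h : v ∈ listSpan (extractBasis l)
    · have e : extractBasis (v :: l) = extractBasis l := if_pos h
      rwa [e]
    · have e : extractBasis (v :: l) = v :: extractBasis l := if_neg h
      rw [e]
      have e1 : (v :: extractBasis l).get = Fin.cons v (extractBasis l).get := by
        funext i
        refine Fin.cases ?_ (fun i => ?_) i <;> rfl
      have e2 : Set.range (extractBasis l).get = {w | w ∈ extractBasis l} := by
        ext w
        simp [List.mem_iff_get]
      rw [e1]
      refine linearIndependent_finCons.mpr ⟨ih, ?_⟩
      rw [e2]
      exact h

/-- Points outside a subspace are separated from it by a symplectic character. -/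
theorem exists_realSign_of_notMem (T : Submodule (ZMod 2) (Phase n)) {x : Phase n} (hx : x ∉ T) :
    ∃ w, (∀ v ∈ T, realSign v w = 1) ∧ realSign x w = -1 := by
  obtain ⟨ℓ, hℓx, hℓ⟩ := Submodule.exists_le_ker_of_notMem hx
  set w : Phase n := (fun i => ℓ (0, Pi.single i 1), fun i => ℓ (Pi.single i 1, 0)) with hw
  have hval : ∀ v : Phase n, ℓ v = w.2 ⬝ᵥ v.1 + v.2 ⬝ᵥ w.1 := by
    intro v
    have e1 : v = ∑ i, v.1 i • ((Pi.single i 1, 0) : Phase n) +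
        ∑ i, v.2 i • ((0, Pi.single i 1) : Phase n) := by
      refine Prod.ext (funext fun j => ?_) (funext fun j => ?_)
      · simp [Prod.fst_sum, Finset.sum_apply, Pi.single_apply]
      · simp [Prod.snd_sum, Finset.sum_apply, Pi.single_apply]
    conv_lhs => rw [e1]
    rw [map_add, map_sum, map_sum, dotProduct, dotProduct]
    simp only [map_smul, smul_eq_mul, hw]
    congr 1
    exact Finset.sum_congr rfl fun i _ => mul_comm _ _
  have hsign : ∀ v, comSign v w = (-1) ^ (ℓ v).val := by
    intro v
    rw [hval, ZMod.val_add, comSign, chi, chi, ← pow_add]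
    exact neg_one_pow_eq_pow_mod_two (R := ℂ) _
  refine ⟨w, fun v hv => ?_, ?_⟩
  · have : ℓ v = 0 := hℓ hv
    rw [realSign, hsign, this]
    simp
  · have h2 : ∀ c : ZMod 2, c ≠ 0 → c = 1 := by decide
    rw [realSign, hsign, h2 _ hℓx]
    simp [ZMod.val_one]

/-! ### Robust generation -/

/-- `v` has a large Weyl correlation with `g`. -/
def IsHeavy (g : Fn n) (v : Phase n) : Prop := 0.7146 * l2Norm g ^ 2 < ‖ip (weyl v g) g‖

/-- Every hyperplane of `𝓛(φ)` misses a heavy element with probability at least `ε`. -/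
def WellSpread (φ : Fn n) (ε : ℝ) (g : Fn n) : Prop :=
  ∀ u ∉ lagrangian φ, ENNReal.ofReal ε ≤ pmfExp (sampleQ g) fun v =>
    ind (v ∈ lagrangian φ ∧ realSign v u = -1 ∧ IsHeavy g v)

theorem pmfExp_forall_not_le {α : Type} (p : PMF α) (P : α → Prop) (m : ℕ) {ε : ℝ} (hε : 0 ≤ ε)
    (h : ENNReal.ofReal ε ≤ pmfExp p fun a => ind (P a)) :
    pmfExp (iidSamples p m) (fun l => ind (∀ a ∈ l, ¬P a)) ≤
      ENNReal.ofReal (Real.exp (-(ε * m))) := by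
  simp only [← list_prod_ind]
  rw [pmfExp_iidSamples_prod]
  have h1 : pmfExp p (fun a => ind (P a)) + pmfExp p (fun a => ind (¬P a)) = 1 := by
    rw [← pmfExp_add]
    simp only [ind_add_ind_not, pmfExp_const]
  have h2 : pmfExp p (fun a => ind (¬P a)) ≤ ENNReal.ofReal (Real.exp (-ε)) := by
    have h3 : pmfExp p (fun a => ind (¬P a)) ≤ 1 - ENNReal.ofReal ε := by
      refine ENNReal.le_sub_of_add_le_left ENNReal.ofReal_ne_top ?_
      rw [← h1]
      gcongr
    refine h3.trans ?_
    rw [← ENNReal.ofReal_one, ← ENNReal.ofReal_sub _ hε]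
    refine ENNReal.ofReal_le_ofReal ?_
    linarith [Real.add_one_le_exp (-ε)]
  calc _ ≤ ENNReal.ofReal (Real.exp (-ε)) ^ m := by gcongr
    _ = _ := by
      rw [← ENNReal.ofReal_pow (Real.exp_nonneg _), ← Real.exp_nat_mul]
      congr 2
      ring

/-- Probability that no heavy sample anticommutes with some `u ∉ 𝓛(φ)`. -/
theorem samples_fail_le {φ g : Fn n} {ε : ℝ} (hε : 0 ≤ ε) (h : WellSpread φ ε g) (m : ℕ) :
    pmfExp (iidSamples (sampleQ g) m) (fun S => ind (∃ u ∉ lagrangian φ, ∀ v ∈ S,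
      ¬(v ∈ lagrangian φ ∧ realSign v u = -1 ∧ IsHeavy g v))) ≤
      ENNReal.ofReal (4 ^ n * Real.exp (-(ε * m))) := by
  classical
  have h1 : ∀ S : List (Phase n), ind (∃ u ∉ lagrangian φ, ∀ v ∈ S,
      ¬(v ∈ lagrangian φ ∧ realSign v u = -1 ∧ IsHeavy g v)) ≤
      ∑ u ∈ Finset.univ.filter (· ∉ lagrangian φ), ind (∀ v ∈ S,
        ¬(v ∈ lagrangian φ ∧ realSign v u = -1 ∧ IsHeavy g v)) := by
    intro S
    by_cases hS : ∃ u ∉ lagrangian φ, ∀ v ∈ S,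
        ¬(v ∈ lagrangian φ ∧ realSign v u = -1 ∧ IsHeavy g v)
    · obtain ⟨u, hu, hS'⟩ := hS
      rw [ind_of_true ⟨u, hu, hS'⟩, ← ind_of_true hS']
      exact Finset.single_le_sum (f := fun u => ind (∀ v ∈ S,
        ¬(v ∈ lagrangian φ ∧ realSign v u = -1 ∧ IsHeavy g v))) (fun _ _ => zero_le)
        (Finset.mem_filter.mpr ⟨Finset.mem_univ u, hu⟩)
    · rw [ind_of_false hS]; exact zero_le
  refine (pmfExp_mono _ h1).trans ?_
  rw [pmfExp_sum]
  calc _ ≤ ∑ _u ∈ Finset.univ.filter (· ∉ lagrangian φ),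
        ENNReal.ofReal (Real.exp (-(ε * m))) := Finset.sum_le_sum fun u hu =>
        pmfExp_forall_not_le _ _ m hε (h u (Finset.mem_filter.mp hu).2)
    _ ≤ ∑ _u : Phase n, ENNReal.ofReal (Real.exp (-(ε * m))) :=
        Finset.sum_le_sum_of_subset (Finset.filter_subset _ _)
    _ = _ := by
        have : (4 : ENNReal) ^ n = 2 ^ n * 2 ^ n := by rw [← mul_pow]; norm_num
        rw [ENNReal.ofReal_mul (by positivity), ENNReal.ofReal_pow (by norm_num)]
        simp [this]

theorem OneBounded.mulDeriv {g : Fn n} (hg : OneBounded g) (a : Vec n) :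
    OneBounded (mulDeriv a g) := by
  intro x
  rw [StabSampling.mulDeriv, norm_mul, RCLike.norm_conj]
  exact mul_le_one₀ (hg _) (norm_nonneg _) (hg _)

/-- The pruned list consists of listed pairs whose correlation is not much below `θ`, and contains
all those whose correlation is somewhat above `θ`. -/
def PruneGood (η θ : ℝ) (g : Fn n) (S F : List (Phase n)) : Prop :=
  (∀ v ∈ S, θ + η < ‖ip (weyl v g) g‖ → v ∈ F) ∧ ∀ v ∈ F, θ - η < ‖ip (weyl v g) g‖

theorem prune_fail_le (N : ℕ) (θ : ℝ) {g : Fn n} (hg : OneBounded g) {η : ℝ} (hη : 0 < η)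
    (S : List (Phase n)) :
    pmfExp (prune N θ g S) (fun F => ind (¬PruneGood η θ g S F)) ≤
      S.length * ENNReal.ofReal (4 * Real.exp (-(N * η ^ 2 / 32))) := by
  induction S with
  | nil =>
    have : prune N θ g [] = PMF.pure [] := rfl
    rw [this, pmfExp_pure, ind_of_false]
    · exact zero_le
    · simp [PruneGood]
  | cons v S ih =>
    have : prune N θ g (v :: S) = (fourEst N (mulDeriv v.1 g) v.2).bind fun c =>
      (prune N θ g S).bind fun F => PMF.pure (if θ < ‖c‖ then v :: F else F) := rfl
    simp only [this, pmfExp_bind, pmfExp_pure]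
    have hpt : ∀ (c : ℂ) (F : List (Phase n)),
        ind (¬PruneGood η θ g (v :: S) (if θ < ‖c‖ then v :: F else F)) ≤
        ind (η < ‖c - fourier (mulDeriv v.1 g) v.2‖) + ind (¬PruneGood η θ g S F) := by
      intro c F
      refine le_trans (ind_mono ?_) (ind_or_le _ _)
      contrapose!
      rintro ⟨hc, hF1, hF2⟩
      have hn := norm_fourier_mulDeriv v g
      have ha := abs_norm_sub_norm_le c (fourier (mulDeriv v.1 g) v.2)
      rw [hn] at ha
      have hb := abs_le.mp (ha.trans hc)
      split_ifs with hθ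
      · refine ⟨fun w hw hw' => ?_, fun w hw => ?_⟩
        · rcases List.mem_cons.mp hw with rfl | hw
          · exact List.mem_cons_self
          · exact List.mem_cons_of_mem _ (hF1 w hw hw')
        · rcases List.mem_cons.mp hw with rfl | hw
          · linarith
          · exact hF2 w hw
      · refine ⟨fun w hw hw' => ?_, hF2⟩
        rcases List.mem_cons.mp hw with rfl | hw
        · exact absurd (by linarith) hθ
        · exact hF1 w hw hw'
    calc _ ≤ pmfExp (fourEst N (mulDeriv v.1 g) v.2) fun c => pmfExp (prune N θ g S) fun F =>
          ind (η < ‖c - fourier (mulDeriv v.1 g) v.2‖) + ind (¬PruneGood η θ g S F) :=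
          pmfExp_mono _ fun c => pmfExp_mono _ fun F => hpt c F
      _ ≤ ENNReal.ofReal (4 * Real.exp (-(N * η ^ 2 / 32))) +
          S.length * ENNReal.ofReal (4 * Real.exp (-(N * η ^ 2 / 32))) := by
          simp only [pmfExp_add, pmfExp_const]
          exact add_le_add (fourEst_tail N (hg.mulDeriv _) _ hη) ih
      _ = _ := by
          rw [List.length_cons]
          push_cast
          ring

/-- Deterministic correctness of the span of the pruned list, when all estimates are accurate. -/
theorem listSpan_eq_lagrangian {φ g : Fn n} (hφ : IsStabilizerState φ) {κ c : ℝ} (hκ : 0 < κ)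
    (hκg : κ ≤ l2Norm g ^ 2) {S F : List (Phase n)}
    (hS : ∀ u ∉ lagrangian φ, ∃ v ∈ S, v ∈ lagrangian φ ∧ realSign v u = -1 ∧ IsHeavy g v)
    (hc : |c - l2Norm g ^ 2| ≤ κ / 1000) (hF : PruneGood (κ / 1000) (0.711 * c) g S F) :
    (listSpan F : Set (Phase n)) = lagrangian φ := by
  obtain ⟨hF1, hF2⟩ := hF
  obtain ⟨hc1, hc2⟩ := abs_le.mp hc
  have hkey : ∀ u ∉ lagrangian φ, ∃ v ∈ F, v ∈ lagrangian φ ∧ realSign v u = -1 := by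
    intro u hu
    obtain ⟨v, hv, hvL, hvu, hh⟩ := hS u hu
    refine ⟨v, hF1 v hv ?_, hvL, hvu⟩
    rw [IsHeavy] at hh
    linarith
  have hcomm : ∀ v ∈ F, ∀ w ∈ F, realSign v w = 1 := by
    intro v hv w hw
    refine (realSign_eq_one_or v w).resolve_right fun h => ?_
    have h1 := weylSq_add_weylSq_le (f := g) h
    have hbig : ∀ v ∈ F, 1 / 2 * l2Norm g ^ 4 < weylSq g v := by
      intro v hv
      have h2 := hF2 v hv
      have h3 : 0.709 * l2Norm g ^ 2 < ‖ip (weyl v g) g‖ := by linarith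
      have h4 : (0.709 * l2Norm g ^ 2) ^ 2 < ‖ip (weyl v g) g‖ ^ 2 := by
        have : 0 ≤ 0.709 * l2Norm g ^ 2 := by positivity
        gcongr
      rw [weylSq]
      have h5 : (0.709 * l2Norm g ^ 2) ^ 2 = 0.709 ^ 2 * l2Norm g ^ 4 := by ring
      have h6 : 0 ≤ l2Norm g ^ 4 := by positivity
      rw [h5] at h4
      norm_num at h4
      linarith
    linarith [hbig v hv, hbig w hw]
  have hFL : ∀ w ∈ F, w ∈ lagrangian φ := by
    intro w hw
    by_contra hwL
    obtain ⟨v, hv, _, hvw⟩ := hkey w hwL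
    have := hcomm v hv w hw
    rw [hvw] at this
    norm_num at this
  apply Set.Subset.antisymm
  · have : listSpan F ≤ hφ.lagrangianSubmodule := Submodule.span_le.mpr fun w hw => hFL w hw
    exact this
  · intro x hx
    by_contra hxF
    obtain ⟨u, hu1, hu2⟩ := exists_realSign_of_notMem (listSpan F) hxF
    have huL : u ∉ lagrangian φ := by
      intro huL
      rw [hφ.isotropic hx huL] at hu2
      norm_num at hu2
    obtain ⟨v, hv, _, hvu⟩ := hkey u huL
    rw [hu1 v (Submodule.subset_span hv)] at hvu
    norm_num at hvu

theorem robustGenerate_eq (K ε δ κ : ℝ) (g : Fn n) :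
    robustGenerate K ε δ κ g = (iidSamples (sampleQ g) (numSamples K n ε δ)).bind fun S =>
      (fourEst (numPoints K (numSamples K n ε δ) (κ / 1000) δ) (mulDeriv 0 g) 0).bind fun c =>
      (prune (numPoints K (numSamples K n ε δ) (κ / 1000) δ) (0.711 * ‖c‖) g S).bind fun F =>
      PMF.pure (extractBasis F) := rfl

theorem sampling_error_le {K ε : ℝ} (hK : 128 ≤ K) (hε : 0 < ε) :
    4 ^ n * Real.exp (-(ε * (numSamples K n ε (1 / 2) : ℕ))) ≤ 1 / 4 := by
  have hm : K * (n + Real.log (1 / (1 / 2))) / ε ≤ (numSamples K n ε (1 / 2) : ℕ) := Nat.le_ceil _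
  have hl : Real.log (1 / (1 / 2)) = Real.log 2 := by norm_num
  rw [hl, div_le_iff₀ hε] at hm
  have h2 := Real.log_two_gt_d9
  have h2' := Real.log_two_lt_d9
  have h4 : (4 : ℝ) ^ n = Real.exp (n * (2 * Real.log 2)) := by
    rw [Real.exp_nat_mul, two_mul, Real.exp_add, Real.exp_log (by norm_num)]
    norm_num
  have h5 : (1 / 4 : ℝ) = Real.exp (-(2 * Real.log 2)) := by
    rw [Real.exp_neg, two_mul, Real.exp_add, Real.exp_log (by norm_num)]
    norm_num
  rw [h4, h5, ← Real.exp_add, Real.exp_le_exp]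
  have hn : (0 : ℝ) ≤ n := Nat.cast_nonneg n
  nlinarith

theorem estimation_error_le {K ε η : ℝ} (hK : 128 ≤ K) (hε : 0 < ε) (hε1 : ε ≤ 1) (hη : 0 < η) :
    ((numSamples K n ε (1 / 2) : ℕ) + 1 : ℝ) * (4 * Real.exp
      (-((numPoints K (numSamples K n ε (1 / 2)) η (1 / 2) : ℕ) * η ^ 2 / 32))) ≤ 1 / 4 := by
  have hm : K * (n + Real.log (1 / (1 / 2))) / ε ≤ (numSamples K n ε (1 / 2) : ℕ) := Nat.le_ceil _
  have hl : Real.log (1 / (1 / 2)) = Real.log 2 := by norm_num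
  rw [hl, div_le_iff₀ hε] at hm
  set m := numSamples K n ε (1 / 2)
  have hN : K * Real.log (m / (1 / 2)) / η ^ 2 ≤ (numPoints K m η (1 / 2) : ℕ) := Nat.le_ceil _
  set N := numPoints K m η (1 / 2)
  have h2 := Real.log_two_gt_d9
  have hn : (0 : ℝ) ≤ n := Nat.cast_nonneg n
  have hm2 : (2 : ℝ) ≤ m := by
    have h3 : (m : ℝ) * ε ≤ m := mul_le_of_le_one_right (Nat.cast_nonneg m) hε1
    nlinarith
  have hm0 : (0 : ℝ) < 2 * m := by linarith
  rw [div_le_iff₀ (by positivity), div_div_eq_mul_div, div_one, mul_comm (m : ℝ) 2] at hN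
  have hlog : 0 ≤ Real.log (2 * m) := Real.log_nonneg (by linarith)
  have hexp : Real.exp (-(N * η ^ 2 / 32)) ≤ ((2 * m : ℝ) ^ 4)⁻¹ := by
    have : ((2 * m : ℝ) ^ 4)⁻¹ = Real.exp (-((4 : ℕ) * Real.log (2 * m))) := by
      rw [Real.exp_neg, Real.exp_nat_mul, Real.exp_log hm0]
    rw [this, Real.exp_le_exp]
    push_cast
    nlinarith
  calc (m + 1 : ℝ) * (4 * Real.exp (-(N * η ^ 2 / 32)))
      ≤ (2 * m) * (4 * ((2 * m : ℝ) ^ 4)⁻¹) := by gcongr; linarith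
    _ = 4 / (2 * m) ^ 3 := by field_simp
    _ ≤ 4 / (2 * 2) ^ 3 := by gcongr
    _ ≤ 1 / 4 := by norm_num

/-- Robust generation fails with probability at most one half. -/
theorem robustGenerate_fail_le {φ g : Fn n} (hφ : IsStabilizerState φ) {K ε κ : ℝ} (hK : 128 ≤ K)
    (hε : 0 < ε) (hε1 : ε ≤ 1) (hκ : 0 < κ) (hκg : κ ≤ l2Norm g ^ 2) (hg : OneBounded g)
    (h : WellSpread φ ε g) :
    pmfExp (robustGenerate K ε (1 / 2) κ g)
      (fun B => ind (¬(listSpan B : Set (Phase n)) = lagrangian φ)) ≤ 1 / 2 := by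
  rw [robustGenerate_eq]
  simp only [pmfExp_bind, pmfExp_pure, listSpan_extractBasis]
  have hsam := sampling_error_le (n := n) hK hε
  have hest := estimation_error_le (n := n) (η := κ / 1000) hK hε hε1 (by positivity)
  set m := numSamples K n ε (1 / 2)
  set N := numPoints K m (κ / 1000) (1 / 2)
  set β := 4 * Real.exp (-(N * (κ / 1000) ^ 2 / 32))
  have hη : 0 < κ / 1000 := by positivity
  have hG : ‖fourier (mulDeriv 0 g) 0‖ = l2Norm g ^ 2 := by
    have := norm_fourier_mulDeriv (0 : Phase n) g
    rw [weyl_zero, ip_self, Complex.norm_real, Real.norm_of_nonneg (sq_nonneg _)] at this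
    exact this
  set bad : List (Phase n) → Prop := fun S => ∃ u ∉ lagrangian φ, ∀ v ∈ S,
    ¬(v ∈ lagrangian φ ∧ realSign v u = -1 ∧ IsHeavy g v) with hbad
  have hpt : ∀ (S : List (Phase n)) (c : ℂ) (F : List (Phase n)),
      ind (¬(listSpan F : Set (Phase n)) = lagrangian φ) ≤
        ind (bad S) + (ind (κ / 1000 < ‖c - fourier (mulDeriv 0 g) 0‖) +
          ind (¬PruneGood (κ / 1000) (0.711 * ‖c‖) g S F)) := by
    intro S c F
    refine le_trans (ind_mono ?_) ((ind_or_le _ _).trans (add_le_add le_rfl (ind_or_le _ _)))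
    contrapose!
    rintro ⟨hS, hc, hF⟩
    refine listSpan_eq_lagrangian (c := ‖c‖) hφ hκ hκg (S := S) ?_ ?_ hF
    · intro u hu
      by_contra hcon
      exact hS ⟨u, hu, fun v hv hv' => hcon ⟨v, hv, hv'⟩⟩
    · rw [← hG]
      exact (abs_norm_sub_norm_le _ _).trans hc
  have hmain : ∀ S : List (Phase n), S.length = m →
      (pmfExp (fourEst N (mulDeriv 0 g) 0) fun c => pmfExp (prune N (0.711 * ‖c‖) g S) fun F =>
        ind (¬(listSpan F : Set (Phase n)) = lagrangian φ)) ≤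
      ind (bad S) + ENNReal.ofReal ((m + 1) * β) := by
    intro S hS
    calc _ ≤ pmfExp (fourEst N (mulDeriv 0 g) 0) fun c => pmfExp (prune N (0.711 * ‖c‖) g S)
          fun F => ind (bad S) + (ind (κ / 1000 < ‖c - fourier (mulDeriv 0 g) 0‖) +
          ind (¬PruneGood (κ / 1000) (0.711 * ‖c‖) g S F)) :=
          pmfExp_mono _ fun c => pmfExp_mono _ fun F => hpt S c F
      _ ≤ pmfExp (fourEst N (mulDeriv 0 g) 0) fun c => ind (bad S) +
          (ind (κ / 1000 < ‖c - fourier (mulDeriv 0 g) 0‖) + m * ENNReal.ofReal β) := by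
          refine pmfExp_mono _ fun c => ?_
          simp only [pmfExp_add, pmfExp_const]
          gcongr
          rw [← hS]
          exact prune_fail_le N _ hg hη S
      _ ≤ ind (bad S) + (ENNReal.ofReal β + m * ENNReal.ofReal β) := by
          simp only [pmfExp_add, pmfExp_const]
          gcongr
          exact fourEst_tail N (hg.mulDeriv _) _ hη
      _ = _ := by
          rw [ENNReal.ofReal_mul (p := (m + 1 : ℝ)) (by positivity),
            ENNReal.ofReal_add (by positivity) zero_le_one, ENNReal.ofReal_natCast, ENNReal.ofReal_one]
          ring
  refine (pmfExp_iidSamples_mono _ m hmain).trans ?_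
  simp only [pmfExp_add, pmfExp_const]
  calc _ ≤ ENNReal.ofReal (1 / 4) + ENNReal.ofReal (1 / 4) :=
        add_le_add ((samples_fail_le hε.le h m).trans (ENNReal.ofReal_le_ofReal hsam))
          (ENNReal.ofReal_le_ofReal hest)
    _ = 1 / 2 := by
        rw [← ENNReal.ofReal_add (by norm_num) (by norm_num)]
        norm_num [ENNReal.ofReal_div_of_pos]

/-! ### One round of boosting -/

theorem pmfExp_sampleQ_ind {g : Fn n} (hg : g ≠ 0) (P : Phase n → Prop) [DecidablePred P] :
    pmfExp (sampleQ g) (fun v => ind (P v)) =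
      ENNReal.ofReal (∑ v, (if P v then 1 else 0) * convDist g v) := by
  rw [pmfExp_fintype, ENNReal.ofReal_sum_of_nonneg]
  · refine Finset.sum_congr rfl fun v _ => ?_
    have : sampleQ g v = ENNReal.ofReal (convDist g v) := by
      rw [sampleQ, dif_neg hg]
      rfl
    rw [this]
    split_ifs with h
    · rw [ind_of_true h, mul_one, one_mul]
    · rw [ind_of_false h, mul_zero, zero_mul, ENNReal.ofReal_zero]
  · intro v _
    have := convDist_nonneg g v
    split_ifs <;> simp [this]

/-- The event that a projection preserves local maximality and decreases the norm substantially. -/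
def StepGood (γ τ : ℝ) (φ g g' : Fn n) : Prop :=
  LocallyMaximal γ τ φ g' ∧ 1.08 * l2Norm g' ≤ l2Norm g

theorem boostStep_eq (g : Fn n) : boostStep g = (sampleQ g).bind fun v =>
    (PMF.uniformOfFintype ℤˣ).bind fun σ => PMF.pure (proj v σ g) := rfl

theorem exists_stepGood {γ τ : ℝ} {φ g : Fn n} (hφ : IsStabilizerState φ)
    (h : LocallyMaximal γ τ φ g) (hγ1 : γ ≤ 1) {v : Phase n} (hv : v ∈ lagrangian φ)
    (hl : ¬IsHeavy g v) : ∃ σ : ℤˣ, StepGood γ τ φ g (proj v σ g) := by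
  obtain ⟨σ, hσ⟩ := hφ.exists_sign hv
  refine ⟨σ, h.proj hγ1 hσ, ?_⟩
  rw [IsHeavy, not_lt] at hl
  have h1 := l2Norm_proj_sq_le v σ g
  rw [← sq_le_sq₀ (by have := l2Norm_nonneg (proj v σ g); positivity) (l2Norm_nonneg g), mul_pow]
  nlinarith [sq_nonneg (l2Norm g)]

theorem boostStep_ge {γ τ : ℝ} {φ g : Fn n} (hφ : IsStabilizerState φ)
    (h : LocallyMaximal γ τ φ g) (hγ : 1 / 2 < γ) (hγ1 : γ ≤ 1) (hτ : 0 < τ)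
    (hw : ¬WellSpread φ ((γ - 1 / 2) ^ 2 * τ ^ 8 / 8) g) :
    ENNReal.ofReal ((γ - 1 / 2) ^ 2 * τ ^ 8 / 8 / 2) ≤
      pmfExp (boostStep g) fun g' => ind (StepGood γ τ φ g g') := by
  classical
  set ε := (γ - 1 / 2) ^ 2 * τ ^ 8 / 8 with hε
  have hε0 : 0 < ε := by
    have : 0 < γ - 1 / 2 := by linarith
    positivity
  have hg : g ≠ 0 := by
    rintro rfl
    have := h.le_ip
    simp only [ip, Pi.zero_apply, zero_mul, Finset.expect_const_zero, norm_zero] at this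
    linarith
  rw [WellSpread] at hw
  push Not at hw
  obtain ⟨u, hu, hlt⟩ := hw
  have hmass : ENNReal.ofReal (9 / 4 * ε) ≤ pmfExp (sampleQ g) fun v =>
      ind (v ∈ lagrangian φ ∧ realSign v u = -1) := by
    rw [pmfExp_sampleQ_ind hg]
    refine ENNReal.ofReal_le_ofReal ((h.mass_anticommuting_ge hφ hγ hγ1 hτ hu).trans
      (le_of_eq (Finset.sum_congr rfl fun v _ => ?_)))
    congr 1
    by_cases hv : v ∈ lagrangian φ
    · rw [(mem_lagrangian_iff φ v).mp hv]
      rcases realSign_eq_one_or v u with h1 | h1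
      · rw [h1, if_neg (by norm_num)]; norm_num
      · rw [h1, if_pos ⟨hv, rfl⟩]; norm_num
    · rw [hφ.weylSq_eq_zero hv, if_neg fun h' => hv h'.1]; norm_num
  have hlight : ENNReal.ofReal ε ≤ pmfExp (sampleQ g) fun v =>
      ind (v ∈ lagrangian φ ∧ ¬IsHeavy g v) := by
    have h1 : (pmfExp (sampleQ g) fun v => ind (v ∈ lagrangian φ ∧ realSign v u = -1)) ≤
        (pmfExp (sampleQ g) fun v => ind (v ∈ lagrangian φ ∧ realSign v u = -1 ∧ IsHeavy g v)) +
        pmfExp (sampleQ g) fun v => ind (v ∈ lagrangian φ ∧ ¬IsHeavy g v) := by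
      rw [← pmfExp_add]
      refine pmfExp_mono _ fun v => (ind_mono ?_).trans (ind_or_le _ _)
      tauto
    have h2 : ENNReal.ofReal ε + ENNReal.ofReal ε ≤ ENNReal.ofReal ε +
        pmfExp (sampleQ g) fun v => ind (v ∈ lagrangian φ ∧ ¬IsHeavy g v) := by
      rw [← ENNReal.ofReal_add hε0.le hε0.le]
      calc ENNReal.ofReal (ε + ε) ≤ ENNReal.ofReal (9 / 4 * ε) :=
            ENNReal.ofReal_le_ofReal (by linarith)
        _ ≤ _ := hmass.trans (h1.trans (add_le_add hlt.le le_rfl))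
    exact (ENNReal.add_le_add_iff_left ENNReal.ofReal_ne_top).mp h2
  rw [boostStep_eq, pmfExp_bind]
  simp only [pmfExp_bind, pmfExp_pure]
  have hpt : ∀ v, 2⁻¹ * ind (v ∈ lagrangian φ ∧ ¬IsHeavy g v) ≤
      pmfExp (PMF.uniformOfFintype ℤˣ) fun σ => ind (StepGood γ τ φ g (proj v σ g)) := by
    intro v
    by_cases hv : v ∈ lagrangian φ ∧ ¬IsHeavy g v
    · obtain ⟨σ, hσ⟩ := exists_stepGood hφ h hγ1 hv.1 hv.2
      rw [pmfExp_uniform]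
      refine le_trans (le_of_eq ?_) (Finset.single_le_sum (f := fun σ : ℤˣ =>
        (Fintype.card ℤˣ : ENNReal)⁻¹ * ind (StepGood γ τ φ g (proj v σ g)))
        (fun _ _ => zero_le) (Finset.mem_univ σ))
      rw [ind_of_true hv]
      simp only [ind_of_true hσ]
      simp
    · rw [ind_of_false hv, mul_zero]; exact zero_le
  refine le_trans ?_ (pmfExp_mono _ hpt)
  rw [pmfExp_const_mul]
  calc ENNReal.ofReal (ε / 2) = 2⁻¹ * ENNReal.ofReal ε := by
        rw [ENNReal.ofReal_div_of_pos (by norm_num), ENNReal.ofReal_ofNat, div_eq_mul_inv, mul_comm]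
    _ ≤ _ := by gcongr

/-! ### The chain of projections -/

theorem boostChain_succ_left (f : Fn n) (k : ℕ) :
    boostChain f (k + 1) = (boostStep f).bind fun g => boostChain g k := by
  have hs : ∀ (f : Fn n) k, boostChain f (k + 1) = (boostChain f k).bind boostStep :=
    fun _ _ => rfl
  induction k with
  | zero =>
    have h0 : ∀ f : Fn n, boostChain f 0 = PMF.pure f := fun _ => rfl
    rw [hs, h0, PMF.pure_bind]
    simp only [h0, PMF.bind_pure]
  | succ k ih =>
    rw [hs, ih, PMF.bind_bind]
    simp only [hs]

theorem pmfExp_boostChain_zero (f : Fn n) (F : Fn n → ENNReal) :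
    pmfExp (boostChain f 0) F = F f := pmfExp_pure f F

theorem sum_boostChain_ge {γ τ : ℝ} {φ : Fn n} (hφ : IsStabilizerState φ) (hγ : 1 / 2 < γ)
    (hγ1 : γ ≤ 1) (hτ : 0 < τ) (hτ1 : τ ≤ 1) (r : ℕ) (g : Fn n) (h : LocallyMaximal γ τ φ g)
    (hr : l2Norm g ≤ τ * 1.08 ^ r) :
    ENNReal.ofReal ((γ - 1 / 2) ^ 2 * τ ^ 8 / 8 / 2) ^ r ≤
      ∑ i ∈ Finset.range (r + 1), pmfExp (boostChain g i) fun g' => ind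
        (LocallyMaximal γ τ φ g' ∧ WellSpread φ ((γ - 1 / 2) ^ 2 * τ ^ 8 / 8) g') := by
  have hstep := fun (g : Fn n) (h : LocallyMaximal γ τ φ g) hw =>
    boostStep_ge hφ h hγ hγ1 hτ hw
  have hd : 0 < γ - 1 / 2 := by linarith
  have hε0 : 0 < (γ - 1 / 2) ^ 2 * τ ^ 8 / 8 / 2 := by positivity
  have hε1 : (γ - 1 / 2) ^ 2 * τ ^ 8 / 8 / 2 ≤ 1 := by
    have h1 : (γ - 1 / 2) ^ 2 ≤ 1 := pow_le_one₀ hd.le (by linarith)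
    have h2 : τ ^ 8 ≤ 1 := pow_le_one₀ hτ.le hτ1
    have := mul_le_one₀ h1 (by positivity) h2
    linarith
  set ε := (γ - 1 / 2) ^ 2 * τ ^ 8 / 8
  set q := ENNReal.ofReal (ε / 2)
  have hq1 : q ≤ 1 := by rw [← ENNReal.ofReal_one]; exact ENNReal.ofReal_le_ofReal hε1
  have hgood : ∀ (g : Fn n) (r : ℕ), LocallyMaximal γ τ φ g → WellSpread φ ε g →
      q ^ r ≤ ∑ i ∈ Finset.range (r + 1), pmfExp (boostChain g i) fun g' => ind
        (LocallyMaximal γ τ φ g' ∧ WellSpread φ ε g') := by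
    intro g r h hw
    refine le_trans ?_ (Finset.single_le_sum (f := fun i => pmfExp (boostChain g i) fun g' => ind
      (LocallyMaximal γ τ φ g' ∧ WellSpread φ ε g')) (fun _ _ => zero_le)
      (Finset.mem_range.mpr (Nat.succ_pos r)))
    simp only [pmfExp_boostChain_zero]
    rw [ind_of_true ⟨h, hw⟩]
    exact pow_le_one' hq1 r
  induction r generalizing g with
  | zero =>
    by_cases hw : WellSpread φ ε g
    · exact hgood g 0 h hw
    · exfalso
      have h1 := hstep g h hw
      have h2 : ∀ g', ind (StepGood γ τ φ g g') = 0 := by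
        intro g'
        refine ind_of_false ?_
        rintro ⟨h3, h4⟩
        have := h3.le_l2Norm hφ
        rw [pow_zero, mul_one] at hr
        linarith
      simp only [h2, pmfExp_const] at h1
      exact absurd h1 (not_le.mpr (ENNReal.ofReal_pos.mpr hε0))
  | succ r ih =>
    by_cases hw : WellSpread φ ε g
    · exact hgood g _ h hw
    · rw [Finset.sum_range_succ']
      refine le_trans ?_ le_self_add
      simp only [boostChain_succ_left, pmfExp_bind]
      rw [← pmfExp_sum]
      have hpt : ∀ g', q ^ r * ind (StepGood γ τ φ g g') ≤ ∑ i ∈ Finset.range (r + 1),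
          pmfExp (boostChain g' i) fun g' => ind
            (LocallyMaximal γ τ φ g' ∧ WellSpread φ ε g') := by
        intro g'
        by_cases hs : StepGood γ τ φ g g'
        · rw [ind_of_true hs, mul_one]
          refine ih g' hs.1 ?_
          have := hs.2
          rw [pow_succ] at hr
          linarith
        · rw [ind_of_false hs, mul_zero]; exact zero_le
      refine le_trans ?_ (pmfExp_mono _ hpt)
      rw [pmfExp_const_mul, pow_succ]
      exact mul_le_mul_right (hstep g h hw) _

/-! ### Lagrangian sampling -/

theorem linearIndependent_of_mem_support {K γ τ : ℝ} {f : Fn n} {B : List (Phase n)}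
    (hB : B ∈ (LagrangianSample K f γ τ).support) : LinearIndependent (ZMod 2) B.get := by
  have e : LagrangianSample K f γ τ = (PMF.uniformOfFintype (Fin (numRounds τ + 1))).bind fun s =>
    (boostChain f s).bind fun g =>
      robustGenerate K ((γ - 1 / 2) ^ 2 * τ ^ 8 / 8) (1 / 2) (τ ^ 2) g := rfl
  rw [e] at hB
  simp only [robustGenerate_eq, PMF.mem_support_bind_iff, PMF.mem_support_pure_iff] at hB
  obtain ⟨_, _, _, _, _, _, _, _, F, _, rfl⟩ := hB
  exact linearIndependent_extractBasis F

theorem lagrangianSample_ge {K γ τ : ℝ} {f φ : Fn n} (hK : 128 ≤ K) (hγ : 1 / 2 < γ) (hγ1 : γ ≤ 1)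
    (hτ : 0 < τ) (hτ1 : τ ≤ 1) (hφ : IsStabilizerState φ) (h : LocallyMaximal γ τ φ f) :
    ENNReal.ofReal (((numRounds τ : ℝ) + 1)⁻¹ *
      (1 / 2 * ((γ - 1 / 2) ^ 2 * τ ^ 8 / 8 / 2) ^ numRounds τ)) ≤
      (LagrangianSample K f γ τ).toOuterMeasure
        {B | (listSpan B : Set (Phase n)) = lagrangian φ} := by
  have e : LagrangianSample K f γ τ = (PMF.uniformOfFintype (Fin (numRounds τ + 1))).bind fun s =>
    (boostChain f s).bind fun g =>
      robustGenerate K ((γ - 1 / 2) ^ 2 * τ ^ 8 / 8) (1 / 2) (τ ^ 2) g := rfl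
  have hd : 0 < γ - 1 / 2 := by linarith
  have hε0 : 0 < (γ - 1 / 2) ^ 2 * τ ^ 8 / 8 := by positivity
  have hε1 : (γ - 1 / 2) ^ 2 * τ ^ 8 / 8 ≤ 1 := by
    have h1 : (γ - 1 / 2) ^ 2 ≤ 1 := pow_le_one₀ hd.le (by linarith)
    have h2 : τ ^ 8 ≤ 1 := pow_le_one₀ hτ.le hτ1
    have := mul_le_one₀ h1 (by positivity) h2
    linarith
  have ht : l2Norm f ≤ τ * 1.08 ^ numRounds τ := by
    refine h.oneBounded.l2Norm_le_one.trans ?_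
    have h1 : Real.logb 1.08 (1 / τ) ≤ (numRounds τ : ℕ) := Nat.le_ceil _
    rw [Real.logb_le_iff_le_rpow (by norm_num) (by positivity), Real.rpow_natCast,
      div_le_iff₀ hτ] at h1
    linarith
  have hchain := sum_boostChain_ge hφ hγ hγ1 hτ hτ1 (numRounds τ) f h ht
  rw [toOuterMeasure_eq_pmfExp, e]
  simp only [pmfExp_bind, Set.mem_ofPred_eq]
  set t := numRounds τ
  set ε := (γ - 1 / 2) ^ 2 * τ ^ 8 / 8
  have hsucc : ∀ g : Fn n, 2⁻¹ * ind (LocallyMaximal γ τ φ g ∧ WellSpread φ ε g) ≤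
      pmfExp (robustGenerate K ε (1 / 2) (τ ^ 2) g)
        fun B => ind ((listSpan B : Set (Phase n)) = lagrangian φ) := by
    intro g
    by_cases hg : LocallyMaximal γ τ φ g ∧ WellSpread φ ε g
    · obtain ⟨hg1, hg2⟩ := hg
      have hκ : τ ^ 2 ≤ l2Norm g ^ 2 := by
        have := hg1.le_l2Norm hφ
        gcongr
      have hfail := robustGenerate_fail_le hφ hK hε0 hε1 (by positivity : 0 < τ ^ 2) hκ
        hg1.oneBounded hg2
      rw [ind_of_true ⟨hg1, hg2⟩, mul_one]
      have htot : (pmfExp (robustGenerate K ε (1 / 2) (τ ^ 2) g)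
          fun B => ind ((listSpan B : Set (Phase n)) = lagrangian φ)) +
          (pmfExp (robustGenerate K ε (1 / 2) (τ ^ 2) g)
          fun B => ind (¬(listSpan B : Set (Phase n)) = lagrangian φ)) = 1 := by
        rw [← pmfExp_add]
        simp only [ind_add_ind_not, pmfExp_const]
      rw [(one_div 2 : (1 / 2 : ENNReal) = 2⁻¹)] at hfail
      have h3 : (2 : ENNReal)⁻¹ + 2⁻¹ ≤ (pmfExp (robustGenerate K ε (1 / 2) (τ ^ 2) g)
          fun B => ind ((listSpan B : Set (Phase n)) = lagrangian φ)) + 2⁻¹ := by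
        rw [ENNReal.inv_two_add_inv_two, ← htot]
        gcongr
      exact (ENNReal.add_le_add_iff_right (by simp)).mp h3
    · rw [ind_of_false hg, mul_zero]; exact zero_le
  rw [pmfExp_uniform, Fintype.card_fin, ← Finset.mul_sum]
  calc _ = ((t + 1 : ℕ) : ENNReal)⁻¹ * (2⁻¹ * ENNReal.ofReal (ε / 2) ^ t) := by
        rw [ENNReal.ofReal_mul (by positivity), ENNReal.ofReal_mul (by norm_num),
          ENNReal.ofReal_inv_of_pos (by positivity), ENNReal.ofReal_pow (by positivity)]
        congr 2
        · rw [← Nat.cast_add_one, ENNReal.ofReal_natCast]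
        · rw [one_div, ENNReal.ofReal_inv_of_pos (by norm_num), ENNReal.ofReal_ofNat]
    _ ≤ ((t + 1 : ℕ) : ENNReal)⁻¹ * (2⁻¹ * ∑ i ∈ Finset.range (t + 1),
          pmfExp (boostChain f i) fun g' => ind (LocallyMaximal γ τ φ g' ∧ WellSpread φ ε g')) := by
        gcongr
    _ ≤ _ := by
        gcongr
        rw [Finset.mul_sum, ← Fin.sum_univ_eq_sum_range (fun i => 2⁻¹ * pmfExp (boostChain f i)
          fun g' => ind (LocallyMaximal γ τ φ g' ∧ WellSpread φ ε g'))]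
        refine Finset.sum_le_sum fun i _ => ?_
        rw [← pmfExp_const_mul]
        exact pmfExp_mono _ hsucc

theorem success_bound {γ τ : ℝ} (hγ : 1 / 2 < γ) (hγ1 : γ ≤ 1) (hτ : 0 < τ) (hτ1 : τ ≤ 1) :
    ((γ - 1 / 2) * τ) ^ (1000 * Real.log (2 / τ)) ≤ ((numRounds τ : ℝ) + 1)⁻¹ *
      (1 / 2 * ((γ - 1 / 2) ^ 2 * τ ^ 8 / 8 / 2) ^ numRounds τ) := by
  have hd : 0 < γ - 1 / 2 := by linarith
  have hd2 : γ - 1 / 2 ≤ 1 / 2 := by linarith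
  set δ := γ - 1 / 2
  set x := δ * τ with hx
  have hx0 : 0 < x := by positivity
  have hxd : x ≤ δ := mul_le_of_le_one_right hd.le hτ1
  have hxt : x ≤ τ := mul_le_of_le_one_left hτ.le (by linarith)
  have hx2 : x ≤ 1 / 2 := hxd.trans hd2
  set t := numRounds τ with ht
  have hlog : 0 ≤ Real.log (1 / τ) := Real.log_nonneg (by rw [le_div_iff₀ hτ]; linarith)
  have h108 : 0.07 ≤ Real.log 1.08 := by
    have := Real.one_sub_inv_le_log_of_pos (by norm_num : (0 : ℝ) < 1.08)
    norm_num at this ⊢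
    linarith
  have htle : (t : ℝ) ≤ Real.log (1 / τ) / 0.07 + 1 := by
    have h1 : 0 ≤ Real.logb 1.08 (1 / τ) := div_nonneg hlog (by linarith)
    have h2 : (t : ℝ) < Real.logb 1.08 (1 / τ) + 1 := Nat.ceil_lt_add_one h1
    have h3 : Real.logb 1.08 (1 / τ) ≤ Real.log (1 / τ) / 0.07 := by
      rw [Real.logb]
      gcongr
    linarith
  have hlog2 : Real.log (2 / τ) = Real.log 2 + Real.log (1 / τ) := by
    rw [← Real.log_mul (by norm_num) (by positivity)]
    congr 1
    ring
  have hl2 := Real.log_two_gt_d9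
  have hexp : ((15 * t + 1 : ℕ) : ℝ) ≤ 1000 * Real.log (2 / τ) := by
    rw [hlog2]
    push_cast
    have : Real.log (1 / τ) / 0.07 = Real.log (1 / τ) * (100 / 7) := by ring
    rw [this] at htle
    linarith
  have hstep : x ^ 14 ≤ δ ^ 2 * τ ^ 8 / 8 / 2 := by
    calc x ^ 14 = x ^ 2 * x ^ 8 * x ^ 4 := by ring
      _ ≤ δ ^ 2 * τ ^ 8 * (1 / 2) ^ 4 := by gcongr
      _ = _ := by ring
  have hcount : x ^ t ≤ ((t : ℝ) + 1)⁻¹ := by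
    have h1 : (t : ℝ) + 1 ≤ 2 ^ t := by exact_mod_cast Nat.lt_two_pow_self (n := t)
    calc x ^ t ≤ (1 / 2) ^ t := by gcongr
      _ = (2 ^ t)⁻¹ := by rw [one_div, inv_pow]
      _ ≤ _ := by gcongr
  calc x ^ (1000 * Real.log (2 / τ)) ≤ x ^ ((15 * t + 1 : ℕ) : ℝ) :=
        Real.rpow_le_rpow_of_exponent_ge hx0 (by linarith) hexp
    _ = x ^ t * (x * (x ^ 14) ^ t) := by
        rw [Real.rpow_natCast, ← pow_mul]
        ring
    _ ≤ _ := by gcongr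

end StabSampling

end

theorem theorem3p9 :
    ∃ K₀ C : ℝ, 0 < K₀ ∧ 0 < C ∧
      ∀ (K : ℝ), K₀ ≤ K →
      ∀ (n : ℕ) (f φ : StabSampling.Fn n) (γ τ : ℝ),
        1 / 2 < γ → γ ≤ 1 → 0 < τ →
        StabSampling.OneBounded f →
        StabSampling.IsApproxLocalMaximizer γ f φ →
        τ ≤ ‖StabSampling.ip f φ‖ →
        (∀ B ∈ (StabSampling.LagrangianSample K f γ τ).support,
          LinearIndependent (ZMod 2) B.get) ∧
        ENNReal.ofReal (((γ - 1 / 2) * τ) ^ (C * Real.log (2 / τ))) ≤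
          (StabSampling.LagrangianSample K f γ τ).toOuterMeasure
            {B | (StabSampling.listSpan B : Set (StabSampling.Phase n)) =
              StabSampling.lagrangian φ} := by
  refine ⟨128, 1000, by norm_num, by norm_num, fun K hK n f φ γ τ hγ hγ1 hτ hf hφ hcorr => ?_⟩
  have hloc := hφ.locallyMaximal hf hcorr
  have hτ1 : τ ≤ 1 := (hloc.le_l2Norm hφ.1).trans hf.l2Norm_le_one
  exact ⟨fun B hB => StabSampling.linearIndependent_of_mem_support hB,
    (ENNReal.ofReal_le_ofReal (StabSampling.success_bound hγ hγ1 hτ hτ1)).trans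
      (StabSampling.lagrangianSample_ge hK hγ hγ1 hτ hτ1 hφ.1 hloc)⟩
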